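/- Let $d\ge 0$ be an integer and write $\langle x\rangle=(1+|x|^2)^{1/2}$ for $x\in\mathbf R^d$. For $m,\mu,r,\rho\in\mathbf R$ let $\operatorname{SG}^{m,\mu}_{r,\rho}(\mathbf R^{2d})$ be the set of all $C^\infty$ functions $a(x,\xi)$ on $\mathbf R^d\times\mathbf R^d$ such that for all multi-indices $\alpha,\beta$ there is a constant $C_{\alpha\beta}$ with $$|\partial_x^\alpha\partial_\xi^\beta a(x,\xi)|\le C_{\alpha\beta}\,\langle x\rangle^{m-r|\alpha|}\langle \xi\rangle^{\mu-\rho|\beta|},\qquad x,\xi\in\mathbf R^d .$$ A real-valued $\varphi\in \operatorname{SG}^{1,1}_{1,1}(\mathbf R^{2d})$ is called a regular phase function if there are constants $c,C>0$ such that for all $x,\xi\in\mathbf R^d$ $$c\langle x\rangle\le\langle\varphi'_\xi(x,\xi)\rangle\le C\langle x\rangle,\qquad c\langle \xi\rangle\le\langle\varphi'_x(x,\xi)\rangle\le C\langle \xi\rangle,\qquad |\det\varphi''_{x\xi}(x,\xi)|\ge c .$$ For such $\varphi$ and $a\in \operatorname{SG}^{0,0}_{r,\rho}(\mathbf R^{2d})$,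 the type I SG Fourier integral operator with phase $\varphi$ and amplitude $a$ is given on $f\in\mathscr S(\mathbf R^d)$ by $$(\operatorname{Op}_\varphi(a)f)(x)=(2\pi)^{-d/2}\int_{\mathbf R^d}e^{i\varphi(x,\xi)}a(x,\xi)\widehat f(\xi)\,d\xi,\qquad \widehat f(\xi)=(2\pi)^{-d/2}\int_{\mathbf R^d}f(x)e^{-i\langle x,\xi\rangle}\,dx .$$ Theorem. Let $r,\rho\ge 0$, let $\varphi$ be a regular phase function and let $a\in \operatorname{SG}^{0,0}_{r,\rho}(\mathbf R^{2d})$. Then $\operatorname{Op}_\varphi(a)$ is bounded on $L^2(\mathbf R^d)$: there is a unique bounded linear operator $T$ on $L^2(\mathbf R^d)$ such that $Tf=\operatorname{Op}_\varphi(a)f$ almost everywhere for every $f\in\mathscr S(\mathbf R^d)$. -/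

import Mathlib

open MeasureTheory
open scoped ContDiff SchwartzMap ENNReal

namespace SGFIO

/-- The Japanese bracket `⟨x⟩ = (1 + |x|²)^{1/2}`. -/
noncomputable def bracket {d : ℕ} (x : EuclideanSpace ℝ (Fin d)) : ℝ :=
  Real.sqrt (1 + ‖x‖ ^ 2)

/-- The partial derivative `∂_{x_i} a` of a function `a (x, ξ)`. -/
noncomputable def partialX {d : ℕ} {F : Type*} [NormedAddCommGroup F] [NormedSpace ℝ F]
    (i : Fin d) (a : EuclideanSpace ℝ (Fin d) × EuclideanSpace ℝ (Fin d) → F) :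
    EuclideanSpace ℝ (Fin d) × EuclideanSpace ℝ (Fin d) → F :=
  fun p => fderiv ℝ a p (EuclideanSpace.single i (1 : ℝ), 0)

/-- The partial derivative `∂_{ξ_i} a` of a function `a (x, ξ)`. -/
noncomputable def partialXi {d : ℕ} {F : Type*} [NormedAddCommGroup F] [NormedSpace ℝ F]
    (i : Fin d) (a : EuclideanSpace ℝ (Fin d) × EuclideanSpace ℝ (Fin d) → F) :
    EuclideanSpace ℝ (Fin d) × EuclideanSpace ℝ (Fin d) → F :=
  fun p => fderiv ℝ a p (0, EuclideanSpace.single i (1 : ℝ))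

/-- The mixed derivative `∂_x^α ∂_ξ^β a`. The multi-indices `α`, `β` are given by the lists `I`, `J`
of coordinate directions, with repetition, so that `|α|` and `|β|` are the lengths of the lists.
For smooth `a` the order of the entries is immaterial. -/
noncomputable def mixedDeriv {d : ℕ} {F : Type*} [NormedAddCommGroup F] [NormedSpace ℝ F]
    (I J : List (Fin d)) (a : EuclideanSpace ℝ (Fin d) × EuclideanSpace ℝ (Fin d) → F) :
    EuclideanSpace ℝ (Fin d) × EuclideanSpace ℝ (Fin d) → F :=
  I.foldr partialX (J.foldr partialXi a)

/-- The class `SG^{m,μ}_{r,ρ}(ℝ^{2d})`: smooth functions with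
`|∂_x^α ∂_ξ^β a(x,ξ)| ≤ C_{αβ} ⟨x⟩^{m - r|α|} ⟨ξ⟩^{μ - ρ|β|}` for all `α`, `β`. -/
def IsSG {d : ℕ} {F : Type*} [NormedAddCommGroup F] [NormedSpace ℝ F] (m μ r ρ : ℝ)
    (a : EuclideanSpace ℝ (Fin d) × EuclideanSpace ℝ (Fin d) → F) : Prop :=
  ContDiff ℝ ∞ a ∧
    ∀ I J : List (Fin d), ∃ C : ℝ, ∀ x ξ : EuclideanSpace ℝ (Fin d),
      ‖mixedDeriv I J a (x, ξ)‖ ≤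
        C * bracket x ^ (m - r * (I.length : ℝ)) * bracket ξ ^ (μ - ρ * (J.length : ℝ))

/-- The gradient `φ'_x (x, ξ)`. -/
noncomputable def gradX {d : ℕ}
    (φ : EuclideanSpace ℝ (Fin d) × EuclideanSpace ℝ (Fin d) → ℝ)
    (p : EuclideanSpace ℝ (Fin d) × EuclideanSpace ℝ (Fin d)) : EuclideanSpace ℝ (Fin d) :=
  WithLp.toLp 2 fun i => partialX i φ p

/-- The gradient `φ'_ξ (x, ξ)`. -/
noncomputable def gradXi {d : ℕ}
    (φ : EuclideanSpace ℝ (Fin d) × EuclideanSpace ℝ (Fin d) → ℝ)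
    (p : EuclideanSpace ℝ (Fin d) × EuclideanSpace ℝ (Fin d)) : EuclideanSpace ℝ (Fin d) :=
  WithLp.toLp 2 fun i => partialXi i φ p

/-- The mixed Hessian `φ''_{xξ} (x, ξ)`. -/
noncomputable def mixedHessian {d : ℕ}
    (φ : EuclideanSpace ℝ (Fin d) × EuclideanSpace ℝ (Fin d) → ℝ)
    (p : EuclideanSpace ℝ (Fin d) × EuclideanSpace ℝ (Fin d)) : Matrix (Fin d) (Fin d) ℝ :=
  Matrix.of fun i j => partialX i (partialXi j φ) p

/-- Simple phase functions: real-valued `φ ∈ SG^{1,1}_{1,1}` with `⟨φ'_ξ(x,ξ)⟩ ≍ ⟨x⟩` and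
`⟨φ'_x(x,ξ)⟩ ≍ ⟨ξ⟩`, uniformly in `x` and `ξ`. -/
structure IsSimplePhase {d : ℕ}
    (φ : EuclideanSpace ℝ (Fin d) × EuclideanSpace ℝ (Fin d) → ℝ) : Prop where
  isSG : IsSG 1 1 1 1 φ
  gradXi_equiv : ∃ c C : ℝ, 0 < c ∧ 0 < C ∧ ∀ x ξ : EuclideanSpace ℝ (Fin d),
    c * bracket x ≤ bracket (gradXi φ (x, ξ)) ∧ bracket (gradXi φ (x, ξ)) ≤ C * bracket x
  gradX_equiv : ∃ c C : ℝ, 0 < c ∧ 0 < C ∧ ∀ x ξ : EuclideanSpace ℝ (Fin d),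
    c * bracket ξ ≤ bracket (gradX φ (x, ξ)) ∧ bracket (gradX φ (x, ξ)) ≤ C * bracket ξ

/-- Regular phase functions: simple phases with `|det φ''_{xξ}| ≥ c > 0` everywhere. -/
structure IsRegularPhase {d : ℕ}
    (φ : EuclideanSpace ℝ (Fin d) × EuclideanSpace ℝ (Fin d) → ℝ) : Prop
    extends IsSimplePhase φ where
  det_bound : ∃ c : ℝ, 0 < c ∧ ∀ x ξ : EuclideanSpace ℝ (Fin d),
    c ≤ |(mixedHessian φ (x, ξ)).det|

/-- The unitary Fourier transform `(2π)^{-d/2} ∫ f(x) e^{-i⟨x,ξ⟩} dx`. -/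
noncomputable def fourier {d : ℕ} (f : EuclideanSpace ℝ (Fin d) → ℂ)
    (ξ : EuclideanSpace ℝ (Fin d)) : ℂ :=
  (((2 * Real.pi) ^ (-(d : ℝ) / 2) : ℝ) : ℂ) *
    ∫ x, f x * Complex.exp (-(Complex.I * ((inner ℝ x ξ : ℝ) : ℂ)))

/-- The type I Fourier integral operator with phase `φ` and amplitude `a`, on Schwartz functions:
`Op_φ(a) f (x) = (2π)^{-d/2} ∫ e^{iφ(x,ξ)} a(x,ξ) f̂(ξ) dξ`. -/
noncomputable def Op {d : ℕ}
    (φ : EuclideanSpace ℝ (Fin d) × EuclideanSpace ℝ (Fin d) → ℝ)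
    (a : EuclideanSpace ℝ (Fin d) × EuclideanSpace ℝ (Fin d) → ℂ)
    (f : 𝓢(EuclideanSpace ℝ (Fin d), ℂ)) (x : EuclideanSpace ℝ (Fin d)) : ℂ :=
  (((2 * Real.pi) ^ (-(d : ℝ) / 2) : ℝ) : ℂ) *
    ∫ ξ, Complex.exp (Complex.I * ((φ (x, ξ) : ℝ) : ℂ)) * a (x, ξ) * fourier (fun y => f y) ξ

end SGFIO

/-! By duality and Plancherel it is enough to bound the bilinear form `∫∫ e^{iφ(x,ξ)} a(x,ξ) h(x)
g(ξ) dx dξ` by a constant times `‖g‖₂ ‖h‖₂`. The phase itself is unbounded and so are its first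
derivatives; the argument only uses that all derivatives of `∂_x ∂_ξ φ` are bounded, which is what
the class `SG^{1,1}_{1,1}` gives, together with the lower bounds `|z-z'| ≤ M |φ'_ξ(z,ξ) -
φ'_ξ(z',ξ)|` and `|ζ-ζ'| ≤ M |φ'_x(x,ζ) - φ'_x(x,ζ')|`. The latter come from Hadamard's global
inversion theorem: the gradient maps are proper because `⟨φ'_ξ⟩ ≳ ⟨x⟩` and `⟨φ'_x⟩ ≳ ⟨ξ⟩`, and their
Jacobians have uniformly bounded inverses because of the determinant condition
(`exists_gradXi_lower`, `exists_gradX_lower`).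

The form is cut into a continuous family of cells centred at `(z,ζ)` by `γ(x-z)³ γ(ξ-ζ)³`. On a
cell, `φ(x,ξ) = φ(x,ζ) + φ(z,ξ) - φ(z,ζ) + r`, where the mixed second difference `r` has derivatives
bounded uniformly in the cell. Hence `γ γ a e^{ir}` is a superposition of characters `e^{2πi⟨p,x-z⟩}
e^{2πi⟨q,ξ-ζ⟩}` with an integrable majorant independent of the cell (`exists_packet_expansion`). For
each frequency the cell integral splits into a wave packet coefficient of `h` times one of `g`.

Cauchy-Schwarz in `(z,ζ)` leaves the square integrability of these coefficients, uniformly in the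
frequency. For fixed `ζ` this is a `TT*` estimate in `z` (`lintegral_enorm_sq_le`): nonstationary
phase gives the Gram kernel of `e^{iφ(z,ξ)} γ(ξ-ζ)` decay `(1+|z-z'|)^{-(d+1)}`
(`exists_gram_bound`). Tonelli in `ζ` then uses the remaining factor `γ(ξ-ζ)`. The coefficients of
`h` are handled by exchanging `x` and `ξ`. The pieces meet in `exists_enorm_bilinear_sq_le`; density
of Schwartz functions gives the operator on `L²`. -/

namespace SGFIO

/-! ### Calculus of families with uniformly bounded derivatives -/

section BddDerivs

variable {P ι W F G A : Type*} [NormedAddCommGroup W] [NormedSpace ℝ W]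
  [NormedAddCommGroup F] [NormedSpace ℝ F] [NormedAddCommGroup G] [NormedSpace ℝ G]
  [NormedRing A] [NormedAlgebra ℝ A]

/-- The iterated derivatives of order at most `n` in the directions `v i` of the functions `f p`
are bounded on `S`, uniformly in the parameter `p`. -/
def BddDerivs {P ι W F : Type*} [NormedAddCommGroup W] [NormedSpace ℝ W]
    [NormedAddCommGroup F] [NormedSpace ℝ F] (v : ι → W) (S : Set W) : ℕ → (P → W → F) → Prop
  | 0, f => ∃ C : ℝ, ∀ p, ∀ w ∈ S, ‖f p w‖ ≤ C
  | n + 1, f => (∃ C : ℝ, ∀ p, ∀ w ∈ S, ‖f p w‖ ≤ C) ∧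
      ∀ i, BddDerivs v S n fun p w => fderiv ℝ (f p) w (v i)

variable {v : ι → W} {S : Set W} {n : ℕ}

theorem contDiff_fderiv_apply {f : W → F} (hf : ContDiff ℝ ∞ f) (u : W) :
    ContDiff ℝ ∞ fun w => fderiv ℝ f w u :=
  (hf.fderiv_right (m := ∞) (by simp)).clm_apply contDiff_const

namespace BddDerivs

theorem bdd {f : P → W → F} (h : BddDerivs v S n f) : ∃ C : ℝ, ∀ p, ∀ w ∈ S, ‖f p w‖ ≤ C := by
  cases n with
  | zero => exact h
  | succ n => exact h.1

theorem congr {f g : P → W → F} (h : BddDerivs v S n g) (hfg : ∀ p w, f p w = g p w) :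
    BddDerivs v S n f := by
  rwa [show f = g from funext fun p => funext (hfg p)]

theorem of_succ {f : P → W → F} (h : BddDerivs v S (n + 1) f) : BddDerivs v S n f := by
  induction n generalizing f with
  | zero => exact h.1
  | succ n ih => exact ⟨h.1, fun i => ih (h.2 i)⟩

theorem reparam {Q : Type*} (σ : Q → P) {f : P → W → F} (h : BddDerivs v S n f) :
    BddDerivs v S n fun q => f (σ q) := by
  induction n generalizing f with
  | zero => obtain ⟨C, hC⟩ := h; exact ⟨C, fun p w hw => hC _ w hw⟩
  | succ n ih =>
    obtain ⟨C, hC⟩ := h.1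
    exact ⟨⟨C, fun p w hw => hC _ w hw⟩, fun i => ih (h.2 i)⟩

theorem zero : BddDerivs v S n fun (_ : P) (_ : W) => (0 : F) := by
  induction n with
  | zero => exact ⟨0, by simp⟩
  | succ n ih => exact ⟨⟨0, by simp⟩, fun i => by simpa using ih⟩

theorem const {c : P → F} {C : ℝ} (hc : ∀ p, ‖c p‖ ≤ C) :
    BddDerivs v S n fun (p : P) (_ : W) => c p := by
  cases n with
  | zero => exact ⟨C, fun p _ _ => hc p⟩
  | succ n => exact ⟨⟨C, fun p _ _ => hc p⟩, fun i => by simpa using zero⟩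

theorem add {f g : P → W → F} (hf' : ∀ p, ContDiff ℝ ∞ (f p)) (hg' : ∀ p, ContDiff ℝ ∞ (g p))
    (hf : BddDerivs v S n f) (hg : BddDerivs v S n g) :
    BddDerivs v S n fun p w => f p w + g p w := by
  have key : ∀ {f g : P → W → F}, (∃ C : ℝ, ∀ p, ∀ w ∈ S, ‖f p w‖ ≤ C) →
      (∃ C : ℝ, ∀ p, ∀ w ∈ S, ‖g p w‖ ≤ C) → ∃ C : ℝ, ∀ p, ∀ w ∈ S, ‖f p w + g p w‖ ≤ C := by
    rintro f g ⟨C, hC⟩ ⟨D, hD⟩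
    exact ⟨C + D, fun p w hw => (norm_add_le _ _).trans (add_le_add (hC p w hw) (hD p w hw))⟩
  induction n generalizing f g with
  | zero => exact key hf hg
  | succ n ih =>
    refine ⟨key hf.1 hg.1, fun i => ?_⟩
    have := ih (fun p => contDiff_fderiv_apply (hf' p) (v i))
      (fun p => contDiff_fderiv_apply (hg' p) (v i)) (hf.2 i) (hg.2 i)
    refine this.congr fun p w => ?_
    rw [fderiv_fun_add ((hf' p).differentiable (by simp) w) ((hg' p).differentiable (by simp) w)]
    rfl

theorem sum {κ : Type*} (s : Finset κ) {f : κ → P → W → F}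
    (hf' : ∀ k p, ContDiff ℝ ∞ (f k p)) (hf : ∀ k, BddDerivs v S n (f k)) :
    BddDerivs v S n fun p w => ∑ k ∈ s, f k p w := by
  classical
  induction s using Finset.induction_on with
  | empty => simpa using zero
  | insert k s hk ih =>
    simp_rw [Finset.sum_insert hk]
    exact add (hf' k) (fun p => ContDiff.sum fun j _ => hf' j p) (hf k) ih

theorem clm (L : F →L[ℝ] G) {f : P → W → F} (hf' : ∀ p, ContDiff ℝ ∞ (f p))
    (hf : BddDerivs v S n f) : BddDerivs v S n fun p w => L (f p w) := by
  have key : ∀ {f : P → W → F}, (∃ C : ℝ, ∀ p, ∀ w ∈ S, ‖f p w‖ ≤ C) →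
      ∃ C : ℝ, ∀ p, ∀ w ∈ S, ‖L (f p w)‖ ≤ C := by
    rintro f ⟨C, hC⟩
    exact ⟨‖L‖ * C, fun p w hw => (L.le_opNorm _).trans
      (mul_le_mul_of_nonneg_left (hC p w hw) (norm_nonneg _))⟩
  induction n generalizing f with
  | zero => exact key hf
  | succ n ih =>
    refine ⟨key hf.1, fun i => ?_⟩
    have := ih (fun p => contDiff_fderiv_apply (hf' p) (v i)) (hf.2 i)
    refine this.congr fun p w => ?_
    have := L.hasFDerivAt.comp w ((hf' p).differentiable (by simp) w).hasFDerivAt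
    exact congrArg (fun l => l (v i)) this.fderiv

theorem ofReal {f : P → W → ℝ} (hf' : ∀ p, ContDiff ℝ ∞ (f p))
    (hf : BddDerivs v S n f) : BddDerivs v S n fun p w => (f p w : ℂ) :=
  clm Complex.ofRealCLM hf' hf

theorem neg {f : P → W → F} (hf' : ∀ p, ContDiff ℝ ∞ (f p))
    (hf : BddDerivs v S n f) : BddDerivs v S n fun p w => -f p w :=
  clm (-ContinuousLinearMap.id ℝ F) hf' hf

theorem mul {f g : P → W → A} (hf' : ∀ p, ContDiff ℝ ∞ (f p)) (hg' : ∀ p, ContDiff ℝ ∞ (g p))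
    (hf : BddDerivs v S n f) (hg : BddDerivs v S n g) :
    BddDerivs v S n fun p w => f p w * g p w := by
  have key : ∀ {f g : P → W → A}, (∃ C : ℝ, ∀ p, ∀ w ∈ S, ‖f p w‖ ≤ C) →
      (∃ C : ℝ, ∀ p, ∀ w ∈ S, ‖g p w‖ ≤ C) → ∃ C : ℝ, ∀ p, ∀ w ∈ S, ‖f p w * g p w‖ ≤ C := by
    rintro f g ⟨C, hC⟩ ⟨D, hD⟩
    exact ⟨C * D, fun p w hw => (norm_mul_le _ _).trans
      (mul_le_mul (hC p w hw) (hD p w hw) (norm_nonneg _) ((norm_nonneg _).trans (hC p w hw)))⟩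
  induction n generalizing f g with
  | zero => exact key hf hg
  | succ n ih =>
    refine ⟨key hf.1 hg.1, fun i => ?_⟩
    have h₁ := ih hf' (fun p => contDiff_fderiv_apply (hg' p) (v i)) hf.of_succ (hg.2 i)
    have h₂ := ih (fun p => contDiff_fderiv_apply (hf' p) (v i)) hg' (hf.2 i) hg.of_succ
    refine (add (fun p => (hf' p).mul (contDiff_fderiv_apply (hg' p) (v i)))
      (fun p => (contDiff_fderiv_apply (hf' p) (v i)).mul (hg' p)) h₁ h₂).congr fun p w => ?_
    rw [fderiv_fun_mul' ((hf' p).differentiable (by simp) w) ((hg' p).differentiable (by simp) w)]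
    rfl

/-- Induction through `(1/f)' = -(1/f)(1/f) f'`. The lower bound is required on all of `W`, not only
on `S`, because the product rule lemmas need `1/f` smooth everywhere. -/
theorem inv {f : P → W → ℝ} {c : ℝ} (hc : 0 < c) (hS : ∀ p w, c ≤ f p w)
    (hf' : ∀ p, ContDiff ℝ ∞ (f p)) (hf : BddDerivs v S n f) :
    BddDerivs v S n fun p w => (f p w)⁻¹ := by
  have hne : ∀ p w, f p w ≠ 0 := fun p w => (hc.trans_le (hS p w)).ne'
  have key : ∃ C : ℝ, ∀ p, ∀ w ∈ S, ‖(f p w)⁻¹‖ ≤ C := by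
    refine ⟨c⁻¹, fun p w _ => ?_⟩
    rw [norm_inv, Real.norm_of_nonneg (hc.le.trans (hS p w))]
    exact inv_anti₀ hc (hS p w)
  have hinv : ∀ p, ContDiff ℝ ∞ fun w => (f p w)⁻¹ := fun p => (hf' p).inv (hne p)
  induction n with
  | zero => exact key
  | succ n ih =>
    refine ⟨key, fun i => ?_⟩
    have h := ih hf.of_succ
    have h₂ := neg (fun p => ((hinv p).mul (hinv p)).mul (contDiff_fderiv_apply (hf' p) (v i)))
      (mul (fun p => (hinv p).mul (hinv p)) (fun p => contDiff_fderiv_apply (hf' p) (v i))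
      (mul hinv hinv h h) (hf.2 i))
    refine h₂.congr fun p w => ?_
    have := (hasDerivAt_inv (hne p w)).comp_hasFDerivAt w
      ((hf' p).differentiable (by simp) w).hasFDerivAt
    refine (congrArg (fun l => l (v i)) this.fderiv).trans ?_
    simp only [neg_smul, smul_apply, neg_apply, smul_eq_mul]
    field_simp

theorem _root_.SGFIO.contDiff_cexp_I {f : W → ℝ} (hf : ContDiff ℝ ∞ f) :
    ContDiff ℝ ∞ fun w => Complex.exp (Complex.I * (f w : ℂ)) :=
  ((contDiff_const.mul (Complex.ofRealCLM.contDiff.comp hf))).cexp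

theorem _root_.SGFIO.norm_cexp_I (t : ℝ) : ‖Complex.exp (Complex.I * (t : ℂ))‖ = 1 := by
  rw [mul_comm]; exact Complex.norm_exp_ofReal_mul_I t

theorem _root_.SGFIO.fderiv_cexp_I {f : W → ℝ} (hf : ContDiff ℝ ∞ f) (w u : W) :
    fderiv ℝ (fun w => Complex.exp (Complex.I * (f w : ℂ))) w u =
      Complex.exp (Complex.I * (f w : ℂ)) * (Complex.I * (fderiv ℝ f w u : ℂ)) := by
  have h1 : HasFDerivAt (fun w => (f w : ℂ)) (Complex.ofRealCLM.comp (fderiv ℝ f w)) w :=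
    Complex.ofRealCLM.hasFDerivAt.comp w (hf.differentiable (by simp) w).hasFDerivAt
  rw [((h1.const_mul Complex.I).cexp).fderiv]
  simp

/-- Only the derivatives of the phase enter the bounds: the exponential has modulus one, and each
differentiation brings down a factor `i f'`. The phase itself may be unbounded. -/
theorem cexp_I {f : P → W → ℝ} (hf' : ∀ p, ContDiff ℝ ∞ (f p))
    (hf : ∀ i, BddDerivs v S n fun p w => fderiv ℝ (f p) w (v i)) :
    BddDerivs v S n fun p w => Complex.exp (Complex.I * (f p w : ℂ)) := by
  have key : ∃ C : ℝ, ∀ p, ∀ w ∈ S, ‖Complex.exp (Complex.I * (f p w : ℂ))‖ ≤ C :=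
    ⟨1, fun p w _ => (norm_cexp_I _).le⟩
  induction n with
  | zero => exact key
  | succ n ih =>
    refine ⟨key, fun i => ?_⟩
    have hd := fun p => contDiff_fderiv_apply (hf' p) (v i)
    have hd' : ∀ p, ContDiff ℝ ∞ fun w => (fderiv ℝ (f p) w (v i) : ℂ) :=
      fun p => Complex.ofRealCLM.contDiff.comp (hd p)
    have h := ih fun j => (hf j).of_succ
    have h₂ := mul (fun p => contDiff_cexp_I (hf' p)) (fun p => contDiff_const.mul (hd' p)) h
      (mul (fun _ => contDiff_const) hd' (const (c := fun _ : P => Complex.I) (C := 1) (by simp))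
        (ofReal hd (hf i).of_succ))
    refine h₂.congr fun p w => ?_
    exact fderiv_cexp_I (hf' p) w (v i)

/-- Passes from directional derivatives along a basis to the norms in Schwartz seminorms, by writing
the differential as the sum of the `b.coord i` tensored with the `i`-th partial derivatives. -/
theorem norm_iteratedFDeriv_le [Fintype ι] (b : Module.Basis ι ℝ W) [FiniteDimensional ℝ W]
    {f : P → W → F} (hf' : ∀ p, ContDiff ℝ ∞ (f p)) (hf : BddDerivs b S n f) :
    ∃ C : ℝ, ∀ p, ∀ w ∈ S, ‖iteratedFDeriv ℝ n (f p) w‖ ≤ C := by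
  induction n generalizing f with
  | zero => simpa using hf.bdd
  | succ n ih =>
    choose C hC using fun i => ih (fun p => contDiff_fderiv_apply (hf' p) (b i)) (hf.2 i)
    let L : ι → F →L[ℝ] (W →L[ℝ] F) := fun i =>
      ContinuousLinearMap.smulRightL ℝ W F (LinearMap.toContinuousLinearMap (b.coord i))
    refine ⟨∑ i, ‖L i‖ * C i, fun p w hw => ?_⟩
    have hfd : fderiv ℝ (f p) = fun w => ∑ i, (L i ∘ fun w => fderiv ℝ (f p) w (b i)) w := by
      ext w u
      conv_lhs => rw [← b.sum_repr u, map_sum]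
      simp [L]
    have hcd : ∀ i, ContDiff ℝ ∞ (L i ∘ fun w => fderiv ℝ (f p) w (b i)) := fun i =>
      (L i).contDiff.comp (contDiff_fderiv_apply (hf' p) (b i))
    rw [← norm_iteratedFDeriv_fderiv, hfd,
      iteratedFDeriv_fun_sum_apply (fun i _ => (hcd i).contDiffAt.of_le (mod_cast le_top))]
    refine norm_sum_le_of_le _ fun i _ => ?_
    refine (ContinuousLinearMap.norm_iteratedFDeriv_comp_left _
      (contDiff_fderiv_apply (hf' p) (b i)).contDiffAt (mod_cast le_top)).trans ?_
    exact mul_le_mul_of_nonneg_left (hC i p w hw) (norm_nonneg _)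

/-- Precomposition with a continuous linear map and a translation depending on the parameter. -/
theorem comp_affine {W' κ : Type*} [NormedAddCommGroup W'] [NormedSpace ℝ W'] {v' : κ → W'}
    (L : W' →L[ℝ] W) (σ : κ → ι) (hL : ∀ k, L (v' k) = v (σ k)) (w₀ : P → W)
    {f : P → W → F} (hf' : ∀ p, ContDiff ℝ ∞ (f p)) (hf : BddDerivs v Set.univ n f) (S' : Set W') :
    BddDerivs v' S' n fun p w => f p (w₀ p + L w) := by
  have key : ∀ {f : P → W → F}, (∃ C : ℝ, ∀ p, ∀ w ∈ Set.univ, ‖f p w‖ ≤ C) →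
      ∃ C : ℝ, ∀ p, ∀ w ∈ S', ‖f p (w₀ p + L w)‖ ≤ C := by
    rintro f ⟨C, hC⟩
    exact ⟨C, fun p w hw => hC p _ (Set.mem_univ _)⟩
  induction n generalizing f with
  | zero => exact key hf
  | succ n ih =>
    refine ⟨key hf.1, fun i => ?_⟩
    have := ih (fun p => contDiff_fderiv_apply (hf' p) (v (σ i))) (hf.2 (σ i))
    refine this.congr fun p w => ?_
    have h2 : HasFDerivAt (fun w => w₀ p + L w) L w := L.hasFDerivAt.const_add _
    have := ((hf' p).differentiable (by simp) (w₀ p + L w)).hasFDerivAt.comp w h2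
    rw [← hL]
    exact congrArg (fun l => l (v' i)) this.fderiv

end BddDerivs

end BddDerivs

theorem fderiv_fderiv_comm {W F : Type*} [NormedAddCommGroup W] [NormedSpace ℝ W]
    [NormedAddCommGroup F] [NormedSpace ℝ F] {f : W → F} (hf : ContDiff ℝ ∞ f) (u v w : W) :
    fderiv ℝ (fun w => fderiv ℝ f w u) w v = fderiv ℝ (fun w => fderiv ℝ f w v) w u := by
  have hd : DifferentiableAt ℝ (fderiv ℝ f) w :=
    (hf.fderiv_right (m := ∞) (by simp)).differentiable (by simp) w
  have h : ∀ u v, fderiv ℝ (fun w => fderiv ℝ f w u) w v = fderiv ℝ (fderiv ℝ f) w v u := by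
    intro u v
    rw [fderiv_clm_apply hd (by fun_prop)]
    simp
  rw [h, h]
  exact (hf.contDiffAt.isSymmSndFDerivAt (by
    rw [minSmoothness_of_isRCLikeNormedField]; exact WithTop.coe_le_coe.2 (le_top : (2 : ℕ∞) ≤ ⊤))) v u

/-! ### Mean value estimates along a subset of the coordinates -/

section MeanValue

variable {ι κ W F : Type*} [NormedAddCommGroup W] [NormedSpace ℝ W] [FiniteDimensional ℝ W]
  [NormedAddCommGroup F] [NormedSpace ℝ F] [Fintype ι]

/-- Mean value inequality for increments in the span of those coordinate directions in which the
partial derivatives are bounded. -/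
theorem exists_norm_sub_le_of_bdd_partial (b : Module.Basis ι ℝ W) (K : Set ι) {f : W → F}
    (hf : ContDiff ℝ ∞ f) (hb : ∀ i ∈ K, ∃ C : ℝ, ∀ w, ‖fderiv ℝ f w (b i)‖ ≤ C) :
    ∃ D : ℝ, 0 ≤ D ∧ ∀ p q, (∀ i ∉ K, b.repr (p - q) i = 0) → ‖f p - f q‖ ≤ D * ‖p - q‖ := by
  have hb' : ∀ i, ∃ C : ℝ, i ∈ K → ∀ w, ‖fderiv ℝ f w (b i)‖ ≤ C := fun i => by
    by_cases hi : i ∈ K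
    · obtain ⟨C, hC⟩ := hb i hi; exact ⟨C, fun _ => hC⟩
    · exact ⟨0, fun h => absurd h hi⟩
  choose C hC using hb'
  let N : ι → ℝ := fun i => ‖LinearMap.toContinuousLinearMap (b.coord i)‖
  refine ⟨∑ i, N i * |C i|, by positivity, fun p q hpq => ?_⟩
  have hline : ∀ t : ℝ, HasDerivAt (fun t : ℝ => f (q + t • (p - q)))
      (fderiv ℝ f (q + t • (p - q)) (p - q)) t := fun t => by
    have h1 : HasDerivAt (fun t : ℝ => q + t • (p - q)) (p - q) t := by
      simpa using ((hasDerivAt_id t).smul_const (p - q)).const_add q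
    exact (hf.differentiable (by simp) _).hasFDerivAt.comp_hasDerivAt t h1
  have hbound : ∀ w, ‖fderiv ℝ f w (p - q)‖ ≤ (∑ i, N i * |C i|) * ‖p - q‖ := fun w => by
    conv_lhs => rw [← b.sum_repr (p - q), map_sum]
    rw [Finset.sum_mul]
    refine norm_sum_le_of_le _ fun i _ => ?_
    rw [map_smul, norm_smul]
    by_cases hi : i ∈ K
    · have h1 : ‖b.repr (p - q) i‖ ≤ N i * ‖p - q‖ :=
        (LinearMap.toContinuousLinearMap (b.coord i)).le_opNorm (p - q)
      calc _ ≤ (N i * ‖p - q‖) * |C i| :=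
            mul_le_mul h1 ((hC i hi w).trans (le_abs_self _)) (norm_nonneg _) (by positivity)
        _ = _ := by ring
    · rw [hpq i hi]; simp; positivity
  have := (convex_univ (𝕜 := ℝ) (E := ℝ)).norm_image_sub_le_of_norm_hasDerivWithin_le
    (fun t _ => (hline t).hasDerivWithinAt) (fun t _ => hbound _) (Set.mem_univ 0) (Set.mem_univ 1)
  simpa using this

/-- If the derivatives of `f` in the directions killed by the coordinate projection `L` are bounded
with all their derivatives, then `f (w₀ + w) - f (w₀ + L w)` has bounded derivatives on balls. -/
theorem BddDerivs.sub_comp_proj (b : Module.Basis ι ℝ W) (L : W →L[ℝ] W) (K : Set ι)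
    (hLK : ∀ i ∈ K, L (b i) = 0) (hL : ∀ i ∉ K, L (b i) = b i) (R : ℝ) {n : ℕ} {f : W → F}
    (hf : ContDiff ℝ ∞ f)
    (hb : ∀ i ∈ K, BddDerivs b Set.univ n fun (_ : Unit) w => fderiv ℝ f w (b i)) :
    BddDerivs b (Metric.closedBall 0 R) n fun (w₀ : W) w => f (w₀ + w) - f (w₀ + L w) := by
  have hrepr : ∀ w, ∀ i ∉ K, b.repr (w - L w) i = 0 := by
    intro w i hi
    have h : (b.coord i).comp (LinearMap.id - L.toLinearMap) = 0 := by
      refine b.ext fun j => ?_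
      by_cases hj : j ∈ K
      · have : j ≠ i := fun h => hi (h ▸ hj)
        simp [hLK j hj, this]
      · simp [hL j hj]
    exact LinearMap.congr_fun h w
  have key : ∀ {f : W → F}, ContDiff ℝ ∞ f →
      (∀ i ∈ K, ∃ C : ℝ, ∀ w, ‖fderiv ℝ f w (b i)‖ ≤ C) →
      ∃ C : ℝ, ∀ w₀ : W, ∀ w ∈ Metric.closedBall (0 : W) R, ‖f (w₀ + w) - f (w₀ + L w)‖ ≤ C := by
    intro f hf hb
    obtain ⟨D, hD, h⟩ := exists_norm_sub_le_of_bdd_partial b K hf hb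
    -- The restriction to a ball enters here: the increment `w - L w` has norm at most `(1 + ‖L‖)
    -- R`.
    refine ⟨D * ((1 + ‖L‖) * R), fun w₀ w hw => ?_⟩
    have hw' : ‖w‖ ≤ R := by simpa using hw
    refine (h _ _ ?_).trans (mul_le_mul_of_nonneg_left ?_ hD)
    · rw [add_sub_add_left_eq_sub]; exact hrepr w
    · rw [add_sub_add_left_eq_sub]
      refine (norm_sub_le _ _).trans ?_
      have := L.le_opNorm w
      nlinarith [norm_nonneg L]
  induction n generalizing f with
  | zero =>
    refine key hf fun i hi => ?_
    obtain ⟨C, hC⟩ := (hb i hi).bdd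
    exact ⟨C, fun w => hC () w (Set.mem_univ _)⟩
  | succ n ih =>
    refine ⟨key hf fun i hi => ?_, fun i => ?_⟩
    · obtain ⟨C, hC⟩ := (hb i hi).bdd
      exact ⟨C, fun w => hC () w (Set.mem_univ _)⟩
    have hd : ∀ (w₀ w : W), HasFDerivAt (fun w => f (w₀ + w) - f (w₀ + L w))
        (fderiv ℝ f (w₀ + w) - (fderiv ℝ f (w₀ + L w)).comp L) w := fun w₀ w => by
      refine HasFDerivAt.sub ?_ ?_
      · exact (hf.differentiable (by simp) _).hasFDerivAt.comp w ((hasFDerivAt_id w).const_add w₀)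
      · exact (hf.differentiable (by simp) _).hasFDerivAt.comp w (L.hasFDerivAt.const_add w₀)
    -- In a direction killed by `L` the second term is constant, so only a derivative bounded by
    -- hypothesis survives. In any other direction the derivative is the same difference formed with
    -- the partial derivative of `f`, and symmetry of second derivatives makes the induction
    -- hypothesis applicable.
    by_cases hi : i ∈ K
    · have h1 := BddDerivs.comp_affine (v' := b) (v := b) (ContinuousLinearMap.id ℝ W) id
        (fun k => rfl) (fun w₀ : W => w₀) (fun _ => contDiff_fderiv_apply hf (b i))
        ((hb i hi).of_succ.reparam (fun _ : W => ())) (Metric.closedBall 0 R)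
      refine h1.congr fun w₀ w => ?_
      rw [(hd w₀ w).fderiv]
      simp [hLK i hi]
    · have h1 := ih (f := fun w => fderiv ℝ f w (b i)) (contDiff_fderiv_apply hf _)
        (fun j hj => ((hb j hj).2 i).congr fun _ w => fderiv_fderiv_comm hf _ _ w)
      refine h1.congr fun w₀ w => ?_
      rw [(hd w₀ w).fderiv]
      simp [hL i hi]

end MeanValue

/-! ### Coordinates and symbol estimates -/

section Coordinates

variable {d : ℕ} {F : Type*} [NormedAddCommGroup F] [NormedSpace ℝ F]

/-- The standard basis of `ℝᵈ`. -/
noncomputable def stdBasis (d : ℕ) : Module.Basis (Fin d) ℝ (EuclideanSpace ℝ (Fin d)) :=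
  (EuclideanSpace.basisFun (Fin d) ℝ).toBasis

@[simp] theorem stdBasis_apply (i : Fin d) : stdBasis d i = EuclideanSpace.single i (1 : ℝ) := by
  simp [stdBasis]

/-- The standard basis of `ℝᵈ × ℝᵈ`. -/
noncomputable def prodBasis (d : ℕ) : Module.Basis (Fin d ⊕ Fin d) ℝ
    (EuclideanSpace ℝ (Fin d) × EuclideanSpace ℝ (Fin d)) :=
  (stdBasis d).prod (stdBasis d)

@[simp] theorem prodBasis_inl (i : Fin d) :
    prodBasis d (Sum.inl i) = (EuclideanSpace.single i (1 : ℝ), 0) := by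
  simp [prodBasis]

@[simp] theorem prodBasis_inr (i : Fin d) :
    prodBasis d (Sum.inr i) = (0, EuclideanSpace.single i (1 : ℝ)) := by
  simp [prodBasis]

theorem contDiff_partialX {f : EuclideanSpace ℝ (Fin d) × EuclideanSpace ℝ (Fin d) → F}
    (hf : ContDiff ℝ ∞ f) (i : Fin d) : ContDiff ℝ ∞ (partialX i f) :=
  contDiff_fderiv_apply hf _

theorem contDiff_partialXi {f : EuclideanSpace ℝ (Fin d) × EuclideanSpace ℝ (Fin d) → F}
    (hf : ContDiff ℝ ∞ f) (i : Fin d) : ContDiff ℝ ∞ (partialXi i f) :=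
  contDiff_fderiv_apply hf _

theorem contDiff_mixedDeriv {f : EuclideanSpace ℝ (Fin d) × EuclideanSpace ℝ (Fin d) → F}
    (hf : ContDiff ℝ ∞ f) (I J : List (Fin d)) : ContDiff ℝ ∞ (mixedDeriv I J f) := by
  have h : ContDiff ℝ ∞ (J.foldr partialXi f) := by
    induction J with
    | nil => exact hf
    | cons j J ih => exact contDiff_partialXi ih j
  induction I with
  | nil => exact h
  | cons i I ih => exact contDiff_partialX ih i

/-- In `mixedDeriv` the `ξ`-derivatives are innermost, so a further one has to be commuted past all
the `x`-derivatives. -/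
theorem partialXi_mixedDeriv {f : EuclideanSpace ℝ (Fin d) × EuclideanSpace ℝ (Fin d) → F}
    (hf : ContDiff ℝ ∞ f) (I J : List (Fin d)) (j : Fin d) :
    partialXi j (mixedDeriv I J f) = mixedDeriv I (j :: J) f := by
  induction I with
  | nil => rfl
  | cons i I ih =>
    calc partialXi j (partialX i (mixedDeriv I J f))
        = partialX i (partialXi j (mixedDeriv I J f)) :=
          funext fun w => fderiv_fderiv_comm (contDiff_mixedDeriv hf I J) _ _ w
      _ = _ := by rw [ih]; rfl

/-- The fixed lists `I₀`, `J₀` allow functions that are bounded only after some differentiation: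
empty lists serve for the amplitude, one entry in each for the phase. -/
theorem bddDerivs_mixedDeriv {f : EuclideanSpace ℝ (Fin d) × EuclideanSpace ℝ (Fin d) → F}
    (hf : ContDiff ℝ ∞ f) {I₀ J₀ : List (Fin d)}
    (hb : ∀ I J, ∃ C : ℝ, ∀ w, ‖mixedDeriv (I ++ I₀) (J ++ J₀) f w‖ ≤ C) (n : ℕ) :
    BddDerivs (prodBasis d) Set.univ n fun (_ : Unit) => mixedDeriv I₀ J₀ f := by
  suffices h : ∀ I J, BddDerivs (prodBasis d) Set.univ n
      fun (_ : Unit) => mixedDeriv (I ++ I₀) (J ++ J₀) f from h [] []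
  have key : ∀ I J, ∃ C : ℝ, ∀ _ : Unit, ∀ w ∈ Set.univ,
      ‖mixedDeriv (I ++ I₀) (J ++ J₀) f w‖ ≤ C := fun I J => by
    obtain ⟨C, hC⟩ := hb I J
    exact ⟨C, fun _ w _ => hC w⟩
  induction n with
  | zero => exact key
  | succ n ih =>
    refine fun I J => ⟨key I J, ?_⟩
    rintro (i | j)
    · refine (ih (i :: I) J).congr fun _ w => ?_
      rw [prodBasis_inl]
      rfl
    · refine (ih I (j :: J)).congr fun _ w => ?_
      rw [prodBasis_inr]
      exact congrFun (partialXi_mixedDeriv hf (I ++ I₀) (J ++ J₀) j) w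

theorem one_le_bracket (x : EuclideanSpace ℝ (Fin d)) : 1 ≤ bracket x := by
  rw [bracket, Real.one_le_sqrt]
  nlinarith [sq_nonneg ‖x‖]

theorem norm_le_bracket (x : EuclideanSpace ℝ (Fin d)) : ‖x‖ ≤ bracket x :=
  Real.le_sqrt_of_sq_le (by linarith)

theorem bracket_le (x : EuclideanSpace ℝ (Fin d)) : bracket x ≤ 1 + ‖x‖ :=
  Real.sqrt_le_iff.2 ⟨by positivity, by nlinarith [norm_nonneg x]⟩

theorem IsSG.exists_bound {m μ r ρ : ℝ}
    {f : EuclideanSpace ℝ (Fin d) × EuclideanSpace ℝ (Fin d) → F} (hf : IsSG m μ r ρ f)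
    (I J : List (Fin d)) (hI : m - r * I.length ≤ 0) (hJ : μ - ρ * J.length ≤ 0) :
    ∃ C : ℝ, ∀ w, ‖mixedDeriv I J f w‖ ≤ C := by
  obtain ⟨C, hC⟩ := hf.2 I J
  refine ⟨|C|, fun w => (hC w.1 w.2).trans ?_⟩
  have h1 := Real.rpow_le_one_of_one_le_of_nonpos (one_le_bracket w.1) hI
  have h2 := Real.rpow_le_one_of_one_le_of_nonpos (one_le_bracket w.2) hJ
  have h3 : 0 ≤ bracket w.1 ^ (m - r * I.length) :=
    Real.rpow_nonneg (zero_le_one.trans (one_le_bracket _)) _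
  have h4 : 0 ≤ bracket w.2 ^ (μ - ρ * J.length) :=
    Real.rpow_nonneg (zero_le_one.trans (one_le_bracket _)) _
  calc _ ≤ |C| * bracket w.1 ^ (m - r * I.length) * bracket w.2 ^ (μ - ρ * J.length) := by
        gcongr; exact le_abs_self C
    _ ≤ |C| * 1 * 1 := by gcongr
    _ = |C| := by ring

theorem IsSG.bddDerivs {r ρ : ℝ} (hr : 0 ≤ r) (hρ : 0 ≤ ρ)
    {f : EuclideanSpace ℝ (Fin d) × EuclideanSpace ℝ (Fin d) → F} (hf : IsSG 0 0 r ρ f) (n : ℕ) :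
    BddDerivs (prodBasis d) Set.univ n fun (_ : Unit) => f :=
  bddDerivs_mixedDeriv (I₀ := []) (J₀ := []) hf.1 (fun _ _ => hf.exists_bound _ _
    (by simp; positivity) (by simp; positivity)) n

/-- One derivative in each variable lowers both orders from 1 to 0, and further derivatives only
lower them more. -/
theorem IsSG.bddDerivs_mixed
    {φ : EuclideanSpace ℝ (Fin d) × EuclideanSpace ℝ (Fin d) → F} (hφ : IsSG 1 1 1 1 φ) (n : ℕ)
    (i j : Fin d) :
    BddDerivs (prodBasis d) Set.univ n fun (_ : Unit) => partialX i (partialXi j φ) :=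
  bddDerivs_mixedDeriv (I₀ := [i]) (J₀ := [j]) hφ.1 (fun _ _ => hφ.exists_bound _ _
    (by simp) (by simp)) n

/-- Difference quotients `(f (z, ξ) - f (z', ξ)) / |z - z'|` have bounded `ξ`-derivatives. -/
theorem bddDerivs_diffQuot
    {f : EuclideanSpace ℝ (Fin d) × EuclideanSpace ℝ (Fin d) → ℝ} (hf : ContDiff ℝ ∞ f) {n : ℕ}
    (hb : ∀ i, BddDerivs (prodBasis d) Set.univ n fun (_ : Unit) => partialX i f) :
    BddDerivs (stdBasis d) Set.univ n
      fun (p : EuclideanSpace ℝ (Fin d) × EuclideanSpace ℝ (Fin d)) ξ =>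
        ‖p.1 - p.2‖⁻¹ * (f (p.1, ξ) - f (p.2, ξ)) := by
  have key : ∀ {f : EuclideanSpace ℝ (Fin d) × EuclideanSpace ℝ (Fin d) → ℝ}, ContDiff ℝ ∞ f →
      (∀ i, ∃ C : ℝ, ∀ _ : Unit, ∀ w ∈ Set.univ, ‖partialX i f w‖ ≤ C) →
      ∃ C : ℝ, ∀ p : EuclideanSpace ℝ (Fin d) × EuclideanSpace ℝ (Fin d),
        ∀ ξ ∈ (Set.univ : Set (EuclideanSpace ℝ (Fin d))),
          ‖‖p.1 - p.2‖⁻¹ * (f (p.1, ξ) - f (p.2, ξ))‖ ≤ C := by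
    intro f hf hb
    obtain ⟨D, hD, h⟩ := exists_norm_sub_le_of_bdd_partial (prodBasis d) (Set.range Sum.inl) hf
      (by
        rintro _ ⟨i, rfl⟩
        obtain ⟨C, hC⟩ := hb i
        refine ⟨C, fun w => ?_⟩
        rw [prodBasis_inl]
        exact hC () w (Set.mem_univ _))
    refine ⟨D, fun p ξ _ => ?_⟩
    have h1 := h (p.1, ξ) (p.2, ξ) (by
      rintro (i | i) hi
      · exact absurd ⟨i, rfl⟩ hi
      · simp [prodBasis])
    have h2 : ‖(p.1, ξ) - (p.2, ξ)‖ = ‖p.1 - p.2‖ := by simp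
    rw [norm_mul, norm_inv, norm_norm]
    rw [h2] at h1
    -- On the diagonal the quotient is 0, by the convention for the inverse of 0.
    rcases (norm_nonneg (p.1 - p.2)).eq_or_lt with h0 | h0
    · rw [← h0]; simpa using hD
    · rw [inv_mul_le_iff₀ h0]; linarith
  induction n generalizing f with
  | zero => exact key hf fun i => (hb i).bdd
  | succ n ih =>
    refine ⟨key hf fun i => (hb i).bdd, fun j => ?_⟩
    refine (ih (contDiff_partialXi hf j) fun i => ?_).congr fun p ξ => ?_
    · refine ((hb i).2 (Sum.inr j)).congr fun _ w => ?_
      rw [prodBasis_inr]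
      exact fderiv_fderiv_comm hf _ _ w
    · have h : ∀ z, HasFDerivAt (fun ξ => f (z, ξ))
          ((fderiv ℝ f (z, ξ)).comp (ContinuousLinearMap.inr ℝ _ _)) ξ := fun z =>
        (hf.differentiable (by simp) (z, ξ)).hasFDerivAt.comp ξ (hasFDerivAt_prodMk_right z ξ)
      refine (congrArg (fun l => l (stdBasis d j))
        (((h p.1).sub (h p.2)).const_mul _).fderiv).trans ?_
      simp [partialXi]

end Coordinates

/-! ### Hadamard's global inversion theorem -/

section GlobalInverse

variable {E : Type*} [NormedAddCommGroup E] [NormedSpace ℝ E] [FiniteDimensional ℝ E]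

/-- Hadamard's global inverse function theorem, in the form of a lower Lipschitz bound. -/
theorem norm_sub_le_of_proper_of_lower_bound_fderiv {f : E → E} (hf : ContDiff ℝ 1 f)
    (hp : Filter.Tendsto f (Filter.cocompact E) (Filter.cocompact E)) {M : ℝ}
    (hM : ∀ x u, ‖u‖ ≤ M * ‖fderiv ℝ f x u‖) (x y : E) : ‖x - y‖ ≤ M * ‖f x - f y‖ := by
  have : CompleteSpace E := FiniteDimensional.complete ℝ E
  have : ProperSpace E := FiniteDimensional.proper ℝ E
  have hinj : ∀ x, Function.Injective (fderiv ℝ f x) := fun x => by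
    refine (injective_iff_map_eq_zero _).2 fun u hu => ?_
    have := hM x u
    rw [hu, norm_zero, mul_zero] at this
    exact norm_le_zero_iff.1 this
  let L : E → E ≃L[ℝ] E := fun x =>
    (LinearEquiv.ofInjectiveEndo (fderiv ℝ f x).toLinearMap (hinj x)).toContinuousLinearEquiv
  have hL : ∀ x, HasStrictFDerivAt f (L x : E →L[ℝ] E) x := fun x =>
    hf.contDiffAt.hasStrictFDerivAt (by simp)
  have hloc : IsLocalHomeomorph f := fun x =>
    ⟨(hL x).toOpenPartialHomeomorph f, (hL x).mem_toOpenPartialHomeomorph_source, rfl⟩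
  have hcl : IsClosedMap f := (isProperMap_iff_tendsto_cocompact.2 ⟨hf.continuous, hp⟩).isClosedMap
  -- A proper local homeomorphism is a covering: the map is closed, and its fibres are compact and
  -- discrete, hence finite.
  have hcov : IsCoveringMap f := by
    rw [isCoveringMap_iff_isCoveringMapOn_univ]
    refine hcl.isCoveringMapOn_of_isLocalHomeomorphOn (fun y _ => ?_) ?_
    · have hc : IsCompact (f ⁻¹' {y}) :=
        (isProperMap_iff_tendsto_cocompact.2 ⟨hf.continuous, hp⟩).isCompact_preimage
          isCompact_singleton
      exact hc.finite (.of_openPartialHomeomorph f subset_rfl fun e _ => by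
        obtain ⟨φ, h1, h2⟩ := hloc e
        exact ⟨φ, h1, h2.symm⟩)
    · simpa [← isLocalHomeomorph_iff_isLocalHomeomorphOn_univ] using hloc
  -- Since `E` is simply connected, the identity lifts through the covering to a section `g` with `g
  -- (f x) = x`. Uniqueness of lifts makes `g` a two-sided inverse, and the bound on its derivative
  -- gives the Lipschitz bound on the convex set `E`.
  obtain ⟨g, ⟨hg0, hg⟩, -⟩ := hcov.existsUnique_continuousMap_lifts (ContinuousMap.id E) (f x) x rfl
  have hfg : ∀ y, f (g y) = y := fun y => congrFun hg y
  have hgf : ∀ y, g (f y) = y := by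
    have h1 : (g ∘ f) = id := by
      refine hcov.eq_of_comp_eq (g.continuous.comp hf.continuous) continuous_id ?_ x hg0
      funext y
      simp [hfg]
    exact congrFun h1
  have hgd : ∀ y, HasFDerivAt g ((L (g y)).symm : E →L[ℝ] E) y := fun y =>
    HasFDerivAt.of_local_left_inverse g.continuous.continuousAt (hL (g y)).hasFDerivAt
      (Filter.Eventually.of_forall hfg)
  have hbd : ∀ y, ‖((L (g y)).symm : E →L[ℝ] E)‖ ≤ |M| := fun y =>
    ContinuousLinearMap.opNorm_le_bound _ (abs_nonneg M) fun u => by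
      have h1 := hM (g y) ((L (g y)).symm u)
      have h2 : fderiv ℝ f (g y) ((L (g y)).symm u) = u := (L (g y)).apply_symm_apply u
      rw [h2] at h1
      exact h1.trans (mul_le_mul_of_nonneg_right (le_abs_self M) (norm_nonneg _))
  have h1 := (convex_univ (𝕜 := ℝ) (E := E)).norm_image_sub_le_of_norm_hasFDerivWithin_le
    (fun y _ => (hgd y).hasFDerivWithinAt) (fun y _ => hbd y) (Set.mem_univ (f y))
    (Set.mem_univ (f x))
  rw [hgf, hgf] at h1
  rcases eq_or_ne x y with rfl | hne
  · simp
  · have h2 : 0 ≤ M := by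
      by_contra hneg
      have h3 := hM x (x - y)
      have h4 : 0 < ‖x - y‖ := norm_pos_iff.2 (sub_ne_zero.2 hne)
      nlinarith [norm_nonneg (fderiv ℝ f x (x - y))]
    rwa [abs_of_nonneg h2] at h1

end GlobalInverse

/-! ### Lower bounds for increments of the phase gradients -/

section Gradient

variable {d : ℕ}

/-- Cramer's rule: `adj(A) A u = det(A) u`, and each cofactor is at most `d! max(1,B)^d`. The
maximum with 1 covers the row of zeros and a one that replaces a row of `A`; one factor `d` sums
over the columns of the adjugate, the other over the coordinates of `u`. -/
theorem norm_le_of_le_abs_det {A : Matrix (Fin d) (Fin d) ℝ} {B c : ℝ} (hc : 0 < c)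
    (hB : ∀ i j, |A i j| ≤ B) (hA : c ≤ |A.det|) (u : EuclideanSpace ℝ (Fin d)) :
    ‖u‖ ≤ d * (d * (d.factorial • max 1 B ^ d)) / c *
      ‖(WithLp.toLp 2 (A.mulVec u.ofLp) : EuclideanSpace ℝ (Fin d))‖ := by
  set v : EuclideanSpace ℝ (Fin d) := WithLp.toLp 2 (A.mulVec u.ofLp) with hv
  have hadj : ∀ i j, |A.adjugate i j| ≤ d.factorial • max 1 B ^ d := fun i j => by
    rw [Matrix.adjugate_apply]
    have := Matrix.det_le (A := A.updateRow j (Pi.single i 1)) (abv := AbsoluteValue.abs)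
      (x := max 1 B) (fun k l => by
        rw [Matrix.updateRow_apply]
        split_ifs with h
        · rcases eq_or_ne l i with rfl | hl
          · simp
          · simp [hl]
        · exact (hB k l).trans (le_max_right _ _))
    simpa using this
  have h1 : ∀ i, A.det * u i = ∑ j, A.adjugate i j * v j := fun i => by
    have : A.adjugate.mulVec (A.mulVec u.ofLp) = A.det • u.ofLp := by
      rw [Matrix.mulVec_mulVec, Matrix.adjugate_mul, Matrix.smul_mulVec, Matrix.one_mulVec]
    exact (congrFun this i).symm
  have h2 : ∀ i, c * |u i| ≤ d * (d.factorial • max 1 B ^ d) * ‖v‖ := fun i => by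
    calc c * |u i| ≤ |A.det| * |u i| := by gcongr
      _ = |∑ j, A.adjugate i j * v j| := by rw [← abs_mul, h1]
      _ ≤ ∑ j, |A.adjugate i j * v j| := Finset.abs_sum_le_sum_abs _ _
      _ ≤ ∑ _j : Fin d, (d.factorial • max 1 B ^ d) * ‖v‖ := by
        refine Finset.sum_le_sum fun j _ => ?_
        rw [abs_mul]
        exact mul_le_mul (hadj i j) (PiLp.norm_apply_le v j) (abs_nonneg _) (by positivity)
      _ = _ := by simp; ring
  have h3 : ‖u‖ ≤ ∑ i, |u i| := by
    conv_lhs => rw [← (stdBasis d).sum_repr u]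
    refine norm_sum_le_of_le _ fun i _ => ?_
    rw [norm_smul]
    simp [stdBasis]
  rw [div_mul_eq_mul_div, le_div_iff₀ hc]
  calc ‖u‖ * c ≤ (∑ i, |u i|) * c := by gcongr
    _ = ∑ i, c * |u i| := by rw [Finset.sum_mul]; simp_rw [mul_comm]
    _ ≤ ∑ _i : Fin d, d * (d.factorial • max 1 B ^ d) * ‖v‖ := Finset.sum_le_sum fun i _ => h2 i
    _ = _ := by simp; ring

/-- Instance of Hadamard's theorem: the growth condition `hp` makes the map proper, and Cramer's
rule inverts its differential uniformly. -/
theorem norm_sub_le_of_jacobian {g : Fin d → EuclideanSpace ℝ (Fin d) → ℝ} {B c c' : ℝ}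
    (hg : ∀ j, ContDiff ℝ ∞ (g j)) (hc : 0 < c) (hc' : 0 < c')
    (hB : ∀ x i j, |fderiv ℝ (g j) x (EuclideanSpace.single i 1)| ≤ B)
    (hdet : ∀ x, c ≤ |(Matrix.of fun j i => fderiv ℝ (g j) x (EuclideanSpace.single i 1)).det|)
    (hp : ∀ x, c' * bracket x ≤
      bracket (WithLp.toLp 2 fun j => g j x : EuclideanSpace ℝ (Fin d)))
    (x y : EuclideanSpace ℝ (Fin d)) :
    ‖x - y‖ ≤ d * (d * (d.factorial • max 1 B ^ d)) / c *
      ‖(WithLp.toLp 2 fun j => g j x : EuclideanSpace ℝ (Fin d)) - WithLp.toLp 2 fun j => g j y‖ := by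
  have hf : ContDiff ℝ ∞ fun x => (WithLp.toLp 2 fun j => g j x : EuclideanSpace ℝ (Fin d)) :=
    contDiff_piLp 2 |>.2 hg
  refine norm_sub_le_of_proper_of_lower_bound_fderiv (hf.of_le (mod_cast le_top)) ?_ ?_ x y
  · rw [← Metric.cobounded_eq_cocompact, ← comap_norm_atTop, Filter.tendsto_comap_iff]
    have h1 : Filter.Tendsto (fun x : EuclideanSpace ℝ (Fin d) => c' * ‖x‖ - 1)
        (Filter.comap norm Filter.atTop) Filter.atTop :=
      Filter.tendsto_atTop_add_const_right _ _
        (Filter.Tendsto.const_mul_atTop hc' Filter.tendsto_comap)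
    refine Filter.tendsto_atTop_mono (fun x => ?_) h1
    have h2 := hp x
    have h3 := bracket_le (WithLp.toLp 2 fun j => g j x : EuclideanSpace ℝ (Fin d))
    have h4 := mul_le_mul_of_nonneg_left (norm_le_bracket x) hc'.le
    simp only [Function.comp]
    linarith
  · intro x u
    have h1 : fderiv ℝ (fun x => (WithLp.toLp 2 fun j => g j x : EuclideanSpace ℝ (Fin d))) x u =
        WithLp.toLp 2 ((Matrix.of fun j i =>
          fderiv ℝ (g j) x (EuclideanSpace.single i 1)).mulVec u.ofLp) := by
      ext j
      have h2 : HasFDerivAt (g j) ((EuclideanSpace.proj j : EuclideanSpace ℝ (Fin d) →L[ℝ] ℝ).comp (fderiv ℝ (fun x =>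
          (WithLp.toLp 2 fun j => g j x : EuclideanSpace ℝ (Fin d))) x)) x :=
        (EuclideanSpace.proj j : EuclideanSpace ℝ (Fin d) →L[ℝ] ℝ).hasFDerivAt.comp x (hf.differentiable (by simp) x).hasFDerivAt
      have h3 : fderiv ℝ (fun x =>
          (WithLp.toLp 2 fun j => g j x : EuclideanSpace ℝ (Fin d))) x u j
          = fderiv ℝ (g j) x u := by
        rw [h2.fderiv]; rfl
      rw [h3]
      conv_lhs => rw [← (stdBasis d).sum_repr u, map_sum]
      simp [Matrix.mulVec, dotProduct, stdBasis, mul_comm]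
    rw [h1]
    exact norm_le_of_le_abs_det hc (fun j i => hB x i j) (hdet x) u

theorem IsRegularPhase.exists_gradXi_lower
    {φ : EuclideanSpace ℝ (Fin d) × EuclideanSpace ℝ (Fin d) → ℝ} (hφ : IsRegularPhase φ) :
    ∃ M : ℝ, ∀ z z' ξ, ‖z - z'‖ ≤ M * ‖gradXi φ (z, ξ) - gradXi φ (z', ξ)‖ := by
  obtain ⟨c, hc, hdet⟩ := hφ.det_bound
  obtain ⟨c', _, hc', _, hp⟩ := hφ.gradXi_equiv
  choose B hB using fun i j => (hφ.isSG.bddDerivs_mixed 0 i j).bdd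
  have hs := hφ.isSG.1
  have hder : ∀ i j z ξ, fderiv ℝ (fun z => partialXi j φ (z, ξ)) z (EuclideanSpace.single i 1) =
      partialX i (partialXi j φ) (z, ξ) := fun i j z ξ => by
    have := ((contDiff_partialXi hs j).differentiable (by simp) (z, ξ)).hasFDerivAt.comp
      (f := fun z => (z, ξ)) z
      (hasFDerivAt_prodMk_left z ξ)
    exact (congrArg (fun l => l (EuclideanSpace.single i 1)) this.fderiv).trans rfl
  refine ⟨_, fun z z' ξ => norm_sub_le_of_jacobian (g := fun j z => partialXi j φ (z, ξ))
    (B := ∑ i, ∑ j, |B i j|) (fun j => (contDiff_partialXi hs j).comp (contDiff_prodMk_left ξ))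
    hc hc' (fun x i j => ?_) (fun x => ?_) (fun x => (hp x ξ).1) z z'⟩
  · rw [hder]
    calc _ ≤ B i j := hB i j () _ (Set.mem_univ _)
      _ ≤ |B i j| := le_abs_self _
      _ ≤ ∑ j, |B i j| := Finset.single_le_sum (f := fun j => |B i j|)
          (fun _ _ => abs_nonneg _) (Finset.mem_univ j)
      _ ≤ _ := Finset.single_le_sum (f := fun i => ∑ j, |B i j|)
          (fun _ _ => by positivity) (Finset.mem_univ i)
  · simp_rw [hder]
    -- The Jacobian of `z ↦ φ'_ξ(z,ξ)` is the transpose of `mixedHessian`.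
    rw [← Matrix.det_transpose]
    exact hdet x ξ

theorem IsRegularPhase.exists_gradX_lower
    {φ : EuclideanSpace ℝ (Fin d) × EuclideanSpace ℝ (Fin d) → ℝ} (hφ : IsRegularPhase φ) :
    ∃ M : ℝ, ∀ ζ ζ' x, ‖ζ - ζ'‖ ≤ M * ‖gradX φ (x, ζ) - gradX φ (x, ζ')‖ := by
  obtain ⟨c, hc, hdet⟩ := hφ.det_bound
  obtain ⟨c', _, hc', _, hp⟩ := hφ.gradX_equiv
  choose B hB using fun i j => (hφ.isSG.bddDerivs_mixed 0 i j).bdd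
  have hs := hφ.isSG.1
  have hder : ∀ i j x ζ, fderiv ℝ (fun ζ => partialX i φ (x, ζ)) ζ (EuclideanSpace.single j 1) =
      partialX i (partialXi j φ) (x, ζ) := fun i j x ζ => by
    have := ((contDiff_partialX hs i).differentiable (by simp) (x, ζ)).hasFDerivAt.comp
      (f := fun ζ => (x, ζ)) ζ
      (hasFDerivAt_prodMk_right x ζ)
    refine (congrArg (fun l => l (EuclideanSpace.single j 1)) this.fderiv).trans ?_
    exact fderiv_fderiv_comm hs _ _ _
  refine ⟨_, fun ζ ζ' x => norm_sub_le_of_jacobian (g := fun i ζ => partialX i φ (x, ζ))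
    (B := ∑ i, ∑ j, |B i j|) (fun j => (contDiff_partialX hs j).comp (contDiff_prodMk_right x))
    hc hc' (fun ζ j i => ?_) (fun ζ => ?_) (fun ζ => (hp x ζ).1) ζ ζ'⟩
  · rw [hder]
    calc _ ≤ B i j := hB i j () _ (Set.mem_univ _)
      _ ≤ |B i j| := le_abs_self _
      _ ≤ ∑ j, |B i j| := Finset.single_le_sum (f := fun j => |B i j|)
          (fun _ _ => abs_nonneg _) (Finset.mem_univ j)
      _ ≤ _ := Finset.single_le_sum (f := fun i => ∑ j, |B i j|)
          (fun _ _ => by positivity) (Finset.mem_univ i)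
  · simp_rw [hder]
    exact hdet x ζ

end Gradient

/-! ### Oscillatory integrals and nonstationary phase -/

section CompactSupport

variable {ι W F : Type*} [NormedAddCommGroup W] [NormedSpace ℝ W]
  [NormedAddCommGroup F] [NormedSpace ℝ F]

theorem BddDerivs.of_hasCompactSupport {v : ι → W} {S : Set W} {n : ℕ} {f : W → F}
    (hf : ContDiff ℝ ∞ f) (hs : HasCompactSupport f) : BddDerivs v S n fun (_ : Unit) => f := by
  have key : ∀ {f : W → F}, ContDiff ℝ ∞ f → HasCompactSupport f →
      ∃ C : ℝ, ∀ _ : Unit, ∀ w ∈ S, ‖f w‖ ≤ C := fun hf hs => by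
    obtain ⟨C, hC⟩ := hs.exists_bound_of_continuous hf.continuous
    exact ⟨C, fun _ w _ => hC w⟩
  induction n generalizing f with
  | zero => exact key hf hs
  | succ n ih =>
    exact ⟨key hf hs, fun i => ih (contDiff_fderiv_apply hf (v i)) (hs.fderiv_apply ℝ (v i))⟩

end CompactSupport

section NonstationaryPhase

variable {d : ℕ} {P : Type*}

/-- The trivial bound, supremum times volume. The supporting ball may move with the parameter, only
its radius being fixed; this is needed for cells centred at arbitrary `ζ`. -/
theorem exists_norm_integral_cexp_le {u : P → EuclideanSpace ℝ (Fin d) → ℂ}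
    (hu : ∃ C : ℝ, ∀ p ξ, ‖u p ξ‖ ≤ C) (ctr : P → EuclideanSpace ℝ (Fin d)) (R : ℝ)
    (hsupp : ∀ p, ∀ ξ ∉ Metric.closedBall (ctr p) R, u p ξ = 0) :
    ∃ C : ℝ, ∀ p, ∀ θ : EuclideanSpace ℝ (Fin d) → ℝ,
      ‖∫ ξ, Complex.exp (Complex.I * (θ ξ : ℂ)) * u p ξ‖ ≤ C := by
  obtain ⟨C, hC⟩ := hu
  refine ⟨C * volume.real (Metric.closedBall (0 : EuclideanSpace ℝ (Fin d)) R), fun p θ => ?_⟩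
  rw [← setIntegral_eq_integral_of_forall_compl_eq_zero (s := Metric.closedBall (ctr p) R)
    fun ξ hξ => by rw [hsupp p ξ hξ, mul_zero]]
  have h1 : volume.real (Metric.closedBall (ctr p) R) =
      volume.real (Metric.closedBall (0 : EuclideanSpace ℝ (Fin d)) R) := by
    simp only [Measure.real, Measure.addHaar_closedBall_center]
  rw [← h1]
  refine norm_setIntegral_le_of_norm_le_const measure_closedBall_lt_top fun ξ _ => ?_
  rw [norm_mul, norm_cexp_I, one_mul]
  exact hC p ξ

/-- The principle of nonstationary phase, uniformly in a family of phases and amplitudes. -/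
theorem exists_norm_integral_cexp_le_pow {Θ : P → EuclideanSpace ℝ (Fin d) → ℝ}
    (hΘ : ∀ p, ContDiff ℝ ∞ (Θ p))
    (hΘb : ∀ n i, BddDerivs (stdBasis d) Set.univ n fun p ξ => fderiv ℝ (Θ p) ξ (stdBasis d i))
    {c : ℝ} (hc : 0 < c) (hΘc : ∀ p ξ, c ≤ ∑ i, fderiv ℝ (Θ p) ξ (stdBasis d i) ^ 2)
    (ctr : P → EuclideanSpace ℝ (Fin d)) (R : ℝ) (N : ℕ)
    {u : P → EuclideanSpace ℝ (Fin d) → ℂ} (hu : ∀ p, ContDiff ℝ ∞ (u p))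
    (hub : ∀ n, BddDerivs (stdBasis d) Set.univ n u)
    (hsupp : ∀ p, ∀ ξ ∉ Metric.closedBall (ctr p) R, u p ξ = 0) :
    ∃ C : ℝ, ∀ p, ∀ l : ℝ, 0 < l →
      ‖∫ ξ, Complex.exp (Complex.I * ((l * Θ p ξ : ℝ) : ℂ)) * u p ξ‖ ≤ C / l ^ N := by
  induction N generalizing u with
  | zero =>
    obtain ⟨C, hC⟩ := (hub 0).bdd
    obtain ⟨D, hD⟩ := exists_norm_integral_cexp_le ⟨C, fun p ξ => hC p ξ (Set.mem_univ _)⟩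
      ctr R hsupp
    exact ⟨D, fun p l _ => by simpa using hD p fun ξ => l * Θ p ξ⟩
  | succ N ih =>
    have hd : ∀ p i, ContDiff ℝ ∞ fun ξ => fderiv ℝ (Θ p) ξ (stdBasis d i) := fun p i =>
      contDiff_fderiv_apply (hΘ p) _
    let q : P → EuclideanSpace ℝ (Fin d) → ℝ := fun p ξ =>
      ∑ i, fderiv ℝ (Θ p) ξ (stdBasis d i) * fderiv ℝ (Θ p) ξ (stdBasis d i)
    have hqc : ∀ p ξ, c ≤ q p ξ := fun p ξ => by simpa only [q, ← sq] using hΘc p ξ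
    have hq : ∀ p, ContDiff ℝ ∞ (q p) := fun p => ContDiff.sum fun i _ => (hd p i).mul (hd p i)
    have hqi : ∀ p, ContDiff ℝ ∞ fun ξ => (q p ξ)⁻¹ := fun p =>
      (hq p).inv fun ξ => (hc.trans_le (hqc p ξ)).ne'
    have hqib : ∀ n, BddDerivs (stdBasis d) Set.univ n fun p ξ => (q p ξ)⁻¹ := fun n =>
      .inv hc hqc hq <| .sum _ (fun i p => (hd p i).mul (hd p i)) fun i =>
        .mul (fun p => hd p i) (fun p => hd p i) (hΘb n i) (hΘb n i)
    -- The vector field `v = ∇Θ/|∇Θ|²` satisfies `v·∇e^{ilΘ} = il e^{ilΘ}`. One integration by parts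
    -- gains `1/l` and replaces the amplitude `u` by `-div(v u)`, which satisfies the same
    -- hypotheses as `u` with the same supporting balls.
    let v : Fin d → P → EuclideanSpace ℝ (Fin d) → ℝ := fun i p ξ =>
      fderiv ℝ (Θ p) ξ (stdBasis d i) * (q p ξ)⁻¹
    have hv : ∀ i p, ContDiff ℝ ∞ (v i p) := fun i p => (hd p i).mul (hqi p)
    have hv' : ∀ i p, ContDiff ℝ ∞ fun ξ => (v i p ξ : ℂ) := fun i p =>
      Complex.ofRealCLM.contDiff.comp (hv i p)
    let w : Fin d → P → EuclideanSpace ℝ (Fin d) → ℂ := fun i p ξ => v i p ξ * u p ξ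
    have hw : ∀ i p, ContDiff ℝ ∞ (w i p) := fun i p => (hv' i p).mul (hu p)
    have hwb : ∀ n i, BddDerivs (stdBasis d) Set.univ n (w i) := fun n i =>
      .mul (hv' i) hu (.ofReal (hv i) (.mul (fun p => hd p i) hqi (hΘb n i) (hqib n))) (hub n)
    have hwc : ∀ i p, HasCompactSupport (w i p) := fun i p =>
      HasCompactSupport.intro (isCompact_closedBall (ctr p) R) fun ξ hξ => by
        simp [w, hsupp p ξ hξ]
    obtain ⟨C, hC⟩ := ih (u := fun p ξ => ∑ i, fderiv ℝ (w i p) ξ (stdBasis d i))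
      (fun p => ContDiff.sum fun i _ => contDiff_fderiv_apply (hw i p) _)
      (fun n => .sum _ (fun i p => contDiff_fderiv_apply (hw i p) _) fun i => (hwb (n + 1) i).2 i)
      (fun p ξ hξ => Finset.sum_eq_zero fun i _ => by
        have : w i p =ᶠ[nhds ξ] fun _ => 0 := by
          filter_upwards [Metric.isClosed_closedBall.isOpen_compl.mem_nhds hξ] with η hη
          simp [w, hsupp p η hη]
        rw [this.fderiv_eq]
        simp)
    refine ⟨C, fun p l hl => ?_⟩
    set e : EuclideanSpace ℝ (Fin d) → ℂ := fun ξ =>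
      Complex.exp (Complex.I * ((l * Θ p ξ : ℝ) : ℂ)) with he
    have hlΘ : ContDiff ℝ ∞ fun ξ => l * Θ p ξ := contDiff_const.mul (hΘ p)
    have hes : ContDiff ℝ ∞ e := contDiff_cexp_I hlΘ
    have hint : ∀ {f g : EuclideanSpace ℝ (Fin d) → ℂ}, ContDiff ℝ ∞ f → ContDiff ℝ ∞ g →
        HasCompactSupport f → Integrable fun ξ => f ξ * g ξ := fun hf hg hs =>
      (hf.continuous.mul hg.continuous).integrable_of_hasCompactSupport hs.mul_right
    have hparts : ∀ i, ∫ ξ, w i p ξ * fderiv ℝ e ξ (stdBasis d i) =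
        -∫ ξ, fderiv ℝ (w i p) ξ (stdBasis d i) * e ξ := fun i =>
      integral_mul_fderiv_eq_neg_fderiv_mul_of_integrable
        (hint (contDiff_fderiv_apply (hw i p) _) hes ((hwc i p).fderiv_apply ℝ _))
        (hint (hw i p) (contDiff_fderiv_apply hes _) (hwc i p))
        (hint (hw i p) hes (hwc i p))
        (fun ξ _ => (hw i p).differentiable (by simp) ξ)
        (fun ξ _ => hes.differentiable (by simp) ξ)
    have hsum : ∀ ξ, ∑ i, w i p ξ * fderiv ℝ e ξ (stdBasis d i) =
        (Complex.I * l) * (e ξ * u p ξ) := fun ξ => by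
      have h1 : ∑ i, (v i p ξ : ℂ) * (fderiv ℝ (Θ p) ξ (stdBasis d i) : ℂ) = 1 := by
        have h2 : ∑ i, v i p ξ * fderiv ℝ (Θ p) ξ (stdBasis d i) = 1 := by
          calc _ = q p ξ * (q p ξ)⁻¹ := by
                simp only [q, v, Finset.sum_mul]
                exact Finset.sum_congr rfl fun i _ => by ring
            _ = 1 := mul_inv_cancel₀ (hc.trans_le (hqc p ξ)).ne'
        exact_mod_cast h2
      calc _ = ∑ i, (Complex.I * l) * (e ξ * u p ξ) *
            ((v i p ξ : ℂ) * (fderiv ℝ (Θ p) ξ (stdBasis d i) : ℂ)) := by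
            refine Finset.sum_congr rfl fun i _ => ?_
            rw [he, fderiv_cexp_I hlΘ, fderiv_const_mul ((hΘ p).differentiable (by simp) ξ)]
            simp only [w, smul_apply, smul_eq_mul, Complex.ofReal_mul]
            ring
        _ = _ := by rw [← Finset.mul_sum, h1, mul_one]
    have hmain : (Complex.I * l) * ∫ ξ, e ξ * u p ξ =
        -∫ ξ, e ξ * ∑ i, fderiv ℝ (w i p) ξ (stdBasis d i) := by
      rw [← integral_const_mul]
      simp_rw [← hsum, Finset.mul_sum]
      rw [integral_finsetSum _ fun i _ =>
        hint (hw i p) (contDiff_fderiv_apply hes _) (hwc i p),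
        integral_finsetSum _ fun i _ => by
          simpa only [mul_comm] using
            hint (contDiff_fderiv_apply (hw i p) _) hes ((hwc i p).fderiv_apply ℝ _),
        ← Finset.sum_neg_distrib]
      refine Finset.sum_congr rfl fun i _ => ?_
      rw [hparts i]
      simp_rw [mul_comm]
    have hn := congrArg norm hmain
    rw [norm_mul, norm_neg, norm_mul, Complex.norm_I, one_mul, Complex.norm_real,
      Real.norm_of_nonneg hl.le] at hn
    have h3 := hC p l hl
    rw [← hn] at h3
    rw [pow_succ, ← div_div, le_div_iff₀ hl]
    linarith

end NonstationaryPhase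

/-! ### Decay of the Gram kernel -/

section Gram

variable {d : ℕ}

/-- Write the phase as `|z-z'| Θ`. The gradient of `Θ` is bounded below by `hM`, and its derivatives
are bounded because they are difference quotients of `φ'_ξ` in `x`. Nonstationary phase with large
parameter `|z-z'|` applies; for `|z-z'| ≤ 1` the trivial bound suffices. -/
theorem exists_gram_bound {φ : EuclideanSpace ℝ (Fin d) × EuclideanSpace ℝ (Fin d) → ℝ}
    (hφ : ContDiff ℝ ∞ φ)
    (hb : ∀ n i j, BddDerivs (prodBasis d) Set.univ n
      fun (_ : Unit) => partialX i (partialXi j φ))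
    {M : ℝ} (hM : ∀ z z' ξ, ‖z - z'‖ ≤ M * ‖gradXi φ (z, ξ) - gradXi φ (z', ξ)‖)
    {γ : EuclideanSpace ℝ (Fin d) → ℝ} (hγ : ContDiff ℝ ∞ γ) (hγs : HasCompactSupport γ) (N : ℕ) :
    ∃ C : ℝ, ∀ ζ z z', ‖∫ ξ, Complex.exp (Complex.I * ((φ (z, ξ) - φ (z', ξ) : ℝ) : ℂ)) *
      ((γ (ξ - ζ) ^ 2 : ℝ) : ℂ)‖ ≤ C * (1 + ‖z - z'‖) ^ (-(N : ℝ)) := by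
  obtain ⟨R, hR⟩ : ∃ R, ∀ ξ ∉ Metric.closedBall (0 : EuclideanSpace ℝ (Fin d)) R, γ ξ = 0 := by
    obtain ⟨R, hR⟩ := hγs.isCompact.isBounded.subset_closedBall (0 : EuclideanSpace ℝ (Fin d))
    exact ⟨R, fun ξ hξ => image_eq_zero_of_notMem_tsupport fun h => hξ (hR h)⟩
  have hsupp : ∀ ζ, ∀ ξ ∉ Metric.closedBall ζ R, ((γ (ξ - ζ) ^ 2 : ℝ) : ℂ) = 0 := by
    intro ζ ξ hξ
    rw [hR (ξ - ζ) (by simpa [dist_eq_norm] using hξ)]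
    simp
  have hus : ∀ ζ : EuclideanSpace ℝ (Fin d), ContDiff ℝ ∞ fun ξ => γ (ξ - ζ) := fun ζ =>
    hγ.comp (contDiff_id.sub contDiff_const)
  have hub : ∀ n, BddDerivs (stdBasis d) Set.univ n
      fun (ζ : EuclideanSpace ℝ (Fin d)) ξ => ((γ (ξ - ζ) ^ 2 : ℝ) : ℂ) := fun n => by
    have h1 : BddDerivs (stdBasis d) Set.univ n
        fun (ζ : EuclideanSpace ℝ (Fin d)) ξ => γ (ξ - ζ) :=
      (BddDerivs.comp_affine (v := stdBasis d) (v' := stdBasis d)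
        (ContinuousLinearMap.id ℝ _) id (fun _ => rfl) (fun ζ => -ζ) (fun _ => hγ)
        ((BddDerivs.of_hasCompactSupport hγ hγs).reparam
          fun _ : EuclideanSpace ℝ (Fin d) => ()) _).congr fun ζ ξ => by
          simp [sub_eq_neg_add]
    refine BddDerivs.ofReal (fun ζ => (hus ζ).pow 2) ((BddDerivs.mul hus hus h1 h1).congr ?_)
    intro ζ ξ
    exact sq _
  obtain ⟨B, hB⟩ := (hub 0).bdd
  obtain ⟨C₀, hC₀⟩ := exists_norm_integral_cexp_le ⟨B, fun p ξ => hB p ξ (Set.mem_univ _)⟩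
    id R hsupp
  -- The diagonal is removed from the parameters, since there `Θ` vanishes and its gradient has no
  -- lower bound.
  let P := {p : EuclideanSpace ℝ (Fin d) × EuclideanSpace ℝ (Fin d) // p.1 ≠ p.2} ×
    EuclideanSpace ℝ (Fin d)
  let Θ : P → EuclideanSpace ℝ (Fin d) → ℝ := fun p ξ =>
    ‖p.1.1.1 - p.1.1.2‖⁻¹ * (φ (p.1.1.1, ξ) - φ (p.1.1.2, ξ))
  have hΘ : ∀ p, ContDiff ℝ ∞ (Θ p) := fun p => contDiff_const.mul
    ((hφ.comp (contDiff_prodMk_right _)).sub (hφ.comp (contDiff_prodMk_right _)))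
  have hΘd : ∀ p ξ i, fderiv ℝ (Θ p) ξ (stdBasis d i) = ‖p.1.1.1 - p.1.1.2‖⁻¹ *
      (partialXi i φ (p.1.1.1, ξ) - partialXi i φ (p.1.1.2, ξ)) := fun p ξ i => by
    have h : ∀ z, HasFDerivAt (fun ξ => φ (z, ξ))
        ((fderiv ℝ φ (z, ξ)).comp (ContinuousLinearMap.inr ℝ _ _)) ξ := fun z =>
      (hφ.differentiable (by simp) (z, ξ)).hasFDerivAt.comp ξ (hasFDerivAt_prodMk_right z ξ)
    refine (congrArg (fun l => l (stdBasis d i))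
      (((h p.1.1.1).sub (h p.1.1.2)).const_mul _).fderiv).trans ?_
    simp [partialXi]
  have hΘb : ∀ n i, BddDerivs (stdBasis d) Set.univ n
      fun p ξ => fderiv ℝ (Θ p) ξ (stdBasis d i) := fun n i =>
    ((bddDerivs_diffQuot (contDiff_partialXi hφ i) fun j => hb n j i).reparam
      fun p : P => p.1.1).congr fun p ξ => hΘd p ξ i
  have hΘc : ∀ p ξ, ((max M 1) ^ 2)⁻¹ ≤ ∑ i, fderiv ℝ (Θ p) ξ (stdBasis d i) ^ 2 := by
    intro p ξ
    have hl : 0 < ‖p.1.1.1 - p.1.1.2‖ := norm_pos_iff.2 (sub_ne_zero.2 p.1.2)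
    have h1 : ∑ i, fderiv ℝ (Θ p) ξ (stdBasis d i) ^ 2 = (‖p.1.1.1 - p.1.1.2‖⁻¹ *
        ‖gradXi φ (p.1.1.1, ξ) - gradXi φ (p.1.1.2, ξ)‖) ^ 2 := by
      rw [mul_pow, EuclideanSpace.norm_sq_eq, Finset.mul_sum]
      refine Finset.sum_congr rfl fun i _ => ?_
      rw [hΘd, mul_pow]
      simp [gradXi]
    have hm : 0 < max M 1 := lt_max_of_lt_right one_pos
    rw [h1, ← inv_pow]
    refine pow_le_pow_left₀ (inv_nonneg.2 hm.le) ?_ 2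
    rw [inv_mul_eq_div, le_div_iff₀ hl, inv_mul_le_iff₀ hm]
    exact (hM _ _ ξ).trans (mul_le_mul_of_nonneg_right (le_max_left _ _) (norm_nonneg _))
  obtain ⟨C₁, hC₁⟩ := exists_norm_integral_cexp_le_pow hΘ hΘb (by positivity) hΘc
    (fun p => p.2) R N (u := fun p ξ => ((γ (ξ - p.2) ^ 2 : ℝ) : ℂ))
    (fun p => Complex.ofRealCLM.contDiff.comp ((hus p.2).pow 2))
    (fun n => (hub n).reparam fun p : P => p.2) (fun p => hsupp p.2)
  -- The factor `2 ^ N` comes from `1 + t ≤ 2 max(1,t)`.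
  refine ⟨2 ^ N * max |C₀| |C₁|, fun ζ z z' => ?_⟩
  have hl0 : (0 : ℝ) < 1 + ‖z - z'‖ := by positivity
  rw [Real.rpow_neg hl0.le, Real.rpow_natCast, ← div_eq_mul_inv, le_div_iff₀ (by positivity)]
  rcases le_total ‖z - z'‖ 1 with h | h
  · have h1 : (1 + ‖z - z'‖) ^ N ≤ 2 ^ N := by gcongr; linarith
    calc _ ≤ |C₀| * 2 ^ N := mul_le_mul ((hC₀ ζ fun ξ => φ (z, ξ) - φ (z', ξ)).trans
          (le_abs_self _)) h1 (by positivity) (abs_nonneg _)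
      _ ≤ max |C₀| |C₁| * 2 ^ N := by gcongr; exact le_max_left _ _
      _ = _ := mul_comm _ _
  · have h0 : 0 < ‖z - z'‖ := by linarith
    have h1 : (1 + ‖z - z'‖) ^ N ≤ 2 ^ N * ‖z - z'‖ ^ N := by
      rw [← mul_pow]; gcongr; linarith
    have h2 := hC₁ (⟨(z, z'), sub_ne_zero.1 (norm_pos_iff.1 h0)⟩, ζ) ‖z - z'‖ h0
    have h3 : ∀ ξ, ‖z - z'‖ * (‖z - z'‖⁻¹ * (φ (z, ξ) - φ (z', ξ))) = φ (z, ξ) - φ (z', ξ) :=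
      fun ξ => mul_inv_cancel_left₀ h0.ne' _
    simp only [Θ, h3] at h2
    have h4 := h2.trans (div_le_div_of_nonneg_right ((le_abs_self C₁).trans
      (le_max_right |C₀| |C₁|)) (by positivity))
    calc _ ≤ max |C₀| |C₁| / ‖z - z'‖ ^ N * (2 ^ N * ‖z - z'‖ ^ N) :=
          mul_le_mul h4 h1 (by positivity) (by positivity)
      _ = _ := by field_simp

end Gram

/-! ### Cauchy-Schwarz, duality and the TT* argument -/

section CauchySchwarz

variable {α : Type*} [MeasurableSpace α] {μ : Measure α}

theorem lintegral_mul_sq_le {f g : α → ℝ≥0∞} (hf : AEMeasurable f μ) (hg : AEMeasurable g μ) :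
    (∫⁻ x, f x * g x ∂μ) ^ 2 ≤ (∫⁻ x, f x ^ 2 ∂μ) * ∫⁻ x, g x ^ 2 ∂μ := by
  have h := ENNReal.lintegral_mul_le_Lp_mul_Lq μ Real.HolderConjugate.two_two hf hg
  have h2 := pow_le_pow_left' h 2
  have hs : ∀ a : ℝ≥0∞, (a ^ (1 / 2 : ℝ)) ^ 2 = a := fun a => by
    rw [← ENNReal.rpow_natCast, ← ENNReal.rpow_mul]
    norm_num
  simpa only [mul_pow, hs, ENNReal.rpow_two, Pi.mul_apply] using h2

theorem enorm_integral_mul_sq_le {f g : α → ℂ} (hf : AEStronglyMeasurable f μ)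
    (hg : AEStronglyMeasurable g μ) :
    ‖∫ x, f x * g x ∂μ‖ₑ ^ 2 ≤ (∫⁻ x, ‖f x‖ₑ ^ 2 ∂μ) * ∫⁻ x, ‖g x‖ₑ ^ 2 ∂μ := by
  refine (pow_le_pow_left' (enorm_integral_le_lintegral_enorm _) 2).trans ?_
  simp_rw [enorm_mul]
  exact lintegral_mul_sq_le hf.enorm hg.enorm

end CauchySchwarz

section Duality

variable {d : ℕ}

/-- An `L²` bound for a continuous function from a bound for its integrals against integrable
functions. -/
theorem lintegral_enorm_sq_le_of_dual {F : EuclideanSpace ℝ (Fin d) → ℂ} (hF : Continuous F)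
    {A : ℝ≥0∞} (hA : ∀ h : EuclideanSpace ℝ (Fin d) → ℂ, Integrable h →
      ‖∫ x, F x * h x‖ₑ ^ 2 ≤ A * ∫⁻ x, ‖h x‖ₑ ^ 2) :
    ∫⁻ x, ‖F x‖ₑ ^ 2 ≤ A := by
  have hcov : AECover (volume : Measure (EuclideanSpace ℝ (Fin d))) Filter.atTop
      fun n : ℕ => Metric.closedBall 0 (n : ℝ) := aecover_closedBall tendsto_natCast_atTop_atTop
  refine le_of_tendsto' (hcov.lintegral_tendsto_of_nat (hF.enorm.measurable.pow_const 2).aemeasurable)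
    fun n => ?_
  set S : Set (EuclideanSpace ℝ (Fin d)) := Metric.closedBall 0 (n : ℝ) with hS
  have hSm : MeasurableSet S := Metric.isClosed_closedBall.measurableSet
  -- Testing with the conjugate of `F` cut off to a ball gives `X² ≤ A X` for the integral `X` of
  -- `|F|²` over the ball. By continuity `X` is finite, so it can be cancelled; then the balls
  -- exhaust the space.
  let h : EuclideanSpace ℝ (Fin d) → ℂ := S.indicator fun x => (starRingEnd ℂ) (F x)
  have hcont : Continuous fun x => (starRingEnd ℂ) (F x) := Complex.continuous_conj.comp hF
  have hint : Integrable h :=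
    (integrable_indicator_iff hSm).2 (hcont.continuousOn.integrableOn_compact
      (isCompact_closedBall _ _))
  have h1 : ∫⁻ x, ‖h x‖ₑ ^ 2 = ∫⁻ x in S, ‖F x‖ₑ ^ 2 := by
    rw [← lintegral_indicator hSm]
    refine lintegral_congr fun x => ?_
    by_cases hx : x ∈ S <;> simp [h, hx]
  have hsq : ∀ x, F x * (starRingEnd ℂ) (F x) = ((‖F x‖ ^ 2 : ℝ) : ℂ) := fun x => by
    rw [Complex.mul_conj, Complex.normSq_eq_norm_sq]
  have h2 : ‖∫ x, F x * h x‖ₑ = ∫⁻ x in S, ‖F x‖ₑ ^ 2 := by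
    have h3 : ∫ x, F x * h x = ((∫ x in S, ‖F x‖ ^ 2 : ℝ) : ℂ) := by
      rw [← integral_complex_ofReal, ← integral_indicator hSm]
      refine integral_congr_ae (Filter.Eventually.of_forall fun x => ?_)
      by_cases hx : x ∈ S <;> simp [h, hx, hsq]
    have h4 : IntegrableOn (fun x => ‖F x‖ ^ 2) S :=
      (hF.norm.pow 2).continuousOn.integrableOn_compact (isCompact_closedBall _ _)
    have h5 := ofReal_integral_norm_eq_lintegral_enorm h4
    rw [h3, ← ofReal_norm, Complex.norm_real, Real.norm_of_nonneg (by positivity)]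
    simpa using h5
  have hfin : ∫⁻ x in S, ‖F x‖ₑ ^ 2 ≠ ⊤ := h2 ▸ enorm_ne_top
  have h6 := hA h hint
  rw [h1, h2, sq] at h6
  rcases eq_or_ne (∫⁻ x in S, ‖F x‖ₑ ^ 2) 0 with h0 | h0
  · rw [h0]; exact zero_le
  · exact (ENNReal.mul_le_mul_iff_left h0 hfin).1 h6

/-- Schur's test for a convolution kernel. The crude inequality `ab ≤ a² + b²` produces two equal
terms, whence the factor 2. -/
theorem lintegral_lintegral_mul_mul_sub_le {H κ : EuclideanSpace ℝ (Fin d) → ℝ≥0∞}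
    (hH : AEMeasurable H) (hκ : Measurable κ) :
    ∫⁻ p : EuclideanSpace ℝ (Fin d) × EuclideanSpace ℝ (Fin d),
      H p.1 * H p.2 * κ (p.1 - p.2) ≤ 2 * (∫⁻ x, κ x) * ∫⁻ x, H x ^ 2 := by
  have hab : ∀ a b : ℝ≥0∞, a * b ≤ a ^ 2 + b ^ 2 := fun a b => by
    rcases le_total a b with h | h
    · calc a * b ≤ b * b := by gcongr
        _ ≤ _ := by rw [← sq]; exact le_add_self
    · calc a * b ≤ a * a := by gcongr
        _ ≤ _ := by rw [← sq]; exact le_self_add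
  have hm : Measurable fun p : EuclideanSpace ℝ (Fin d) × EuclideanSpace ℝ (Fin d) =>
      κ (p.1 - p.2) := hκ.comp (measurable_fst.sub measurable_snd)
  have hm1 : AEMeasurable fun p : EuclideanSpace ℝ (Fin d) × EuclideanSpace ℝ (Fin d) =>
      H p.1 ^ 2 * κ (p.1 - p.2) := (hH.comp_fst.pow_const 2).mul hm.aemeasurable
  have hm2 : AEMeasurable fun p : EuclideanSpace ℝ (Fin d) × EuclideanSpace ℝ (Fin d) =>
      H p.2 ^ 2 * κ (p.1 - p.2) := (hH.comp_snd.pow_const 2).mul hm.aemeasurable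
  have e1 : ∫⁻ p : EuclideanSpace ℝ (Fin d) × EuclideanSpace ℝ (Fin d),
      H p.1 ^ 2 * κ (p.1 - p.2) = (∫⁻ x, κ x) * ∫⁻ x, H x ^ 2 := by
    rw [Measure.volume_eq_prod, lintegral_prod _ hm1, ← lintegral_const_mul'' _ (hH.pow_const 2)]
    refine lintegral_congr fun x => ?_
    change ∫⁻ y, H x ^ 2 * κ (x - y) = _
    rw [lintegral_const_mul _ (f := fun y => κ (x - y))
        (hκ.comp (measurable_const.sub measurable_id)),
      lintegral_sub_left_eq_self, mul_comm]
  have e2 : ∫⁻ p : EuclideanSpace ℝ (Fin d) × EuclideanSpace ℝ (Fin d),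
      H p.2 ^ 2 * κ (p.1 - p.2) = (∫⁻ x, κ x) * ∫⁻ x, H x ^ 2 := by
    rw [Measure.volume_eq_prod, lintegral_prod_symm _ hm2,
      ← lintegral_const_mul'' _ (hH.pow_const 2)]
    refine lintegral_congr fun x => ?_
    change ∫⁻ y, H x ^ 2 * κ (y - x) = _
    rw [lintegral_const_mul _ (f := fun y => κ (y - x))
        (hκ.comp (measurable_id.sub measurable_const)),
      lintegral_sub_right_eq_self, mul_comm]
  calc _ ≤ ∫⁻ p : EuclideanSpace ℝ (Fin d) × EuclideanSpace ℝ (Fin d),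
        (H p.1 ^ 2 * κ (p.1 - p.2) + H p.2 ^ 2 * κ (p.1 - p.2)) := by
        refine lintegral_mono fun p => ?_
        rw [← add_mul]
        gcongr
        exact hab _ _
    _ = _ := by rw [lintegral_add_left' hm1, e1, e2]; ring

/-- The `TT*` argument: if `∫ k(z,ξ) conj k(z',ξ) dξ` is bounded by `κ (z - z')` then the operator
`h ↦ ∫ k(z,ξ) h(z) dz` is bounded on `L²`. -/
theorem lintegral_enorm_sq_transpose_le {k : EuclideanSpace ℝ (Fin d) × EuclideanSpace ℝ (Fin d) → ℂ}
    (hk : Continuous k) {B : ℝ} (hB : ∀ p, ‖k p‖ ≤ B) {S : Set (EuclideanSpace ℝ (Fin d))}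
    (hS : IsCompact S) (hkS : ∀ z, ∀ ξ ∉ S, k (z, ξ) = 0)
    {κ : EuclideanSpace ℝ (Fin d) → ℝ≥0∞} (hκ : Measurable κ)
    (hgram : ∀ z z', ‖∫ ξ, k (z, ξ) * (starRingEnd ℂ) (k (z', ξ))‖ₑ ≤ κ (z - z'))
    {h : EuclideanSpace ℝ (Fin d) → ℂ} (hh : Integrable h) :
    ∫⁻ ξ, ‖∫ z, k (z, ξ) * h z‖ₑ ^ 2 ≤ 2 * (∫⁻ x, κ x) * ∫⁻ x, ‖h x‖ₑ ^ 2 := by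
  set W : EuclideanSpace ℝ (Fin d) → ℂ := fun ξ => ∫ z, k (z, ξ) * h z with hW
  let Φ : EuclideanSpace ℝ (Fin d) → EuclideanSpace ℝ (Fin d) × EuclideanSpace ℝ (Fin d) → ℂ :=
    fun ξ p => (k (p.1, ξ) * h p.1) * (starRingEnd ℂ) (k (p.2, ξ) * h p.2)
  have hWW : ∀ ξ, W ξ * (starRingEnd ℂ) (W ξ) = ∫ p, Φ ξ p := fun ξ => by
    simp only [hW, Φ]
    rw [← integral_conj, Measure.volume_eq_prod]
    exact (integral_prod_mul (fun z => k (z, ξ) * h z)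
      fun z => (starRingEnd ℂ) (k (z, ξ) * h z)).symm
  have hΦint : Integrable (Function.uncurry Φ) := by
    have hconj : Integrable fun x => (starRingEnd ℂ) (h x) := by
      refine ⟨Complex.continuous_conj.comp_aestronglyMeasurable hh.1, ?_⟩
      have := hh.2
      simpa [HasFiniteIntegral] using this
    -- Compactness of `S` gives integrability in `ξ`, which justifies Fubini for `|∫ k(z,ξ) h(z)
    -- dz|²` written as a double integral over `(z,z')`.
    have h1 : Integrable (fun ξ => S.indicator (fun _ => (1 : ℂ)) ξ) :=
      (integrable_indicator_iff hS.measurableSet).2 (integrableOn_const hS.measure_lt_top.ne)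
    have h2 := h1.mul_prod (hh.mul_prod hconj)
    have h3 : Continuous fun q : EuclideanSpace ℝ (Fin d) ×
        EuclideanSpace ℝ (Fin d) × EuclideanSpace ℝ (Fin d) =>
        k (q.2.1, q.1) * (starRingEnd ℂ) (k (q.2.2, q.1)) :=
      (hk.comp (by fun_prop)).mul (Complex.continuous_conj.comp (hk.comp (by fun_prop)))
    have h4 := h2.bdd_mul (c := B * B) h3.aestronglyMeasurable (Filter.Eventually.of_forall
      fun q => by
        rw [norm_mul, RCLike.norm_conj]
        exact mul_le_mul (hB _) (hB _) (norm_nonneg _) ((norm_nonneg _).trans (hB (q.1, q.1))))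
    refine h4.congr (Filter.Eventually.of_forall fun q => ?_)
    by_cases hq : q.1 ∈ S
    · simp only [Function.uncurry, Φ, hq, Set.indicator_of_mem, map_mul]
      ring
    · simp [Function.uncurry, Φ, hq, hkS _ _ hq]
  have hWint : Integrable fun ξ => W ξ * (starRingEnd ℂ) (W ξ) := by
    simp_rw [hWW]
    exact hΦint.integral_prod_left
  have e1 : ∫⁻ ξ, ‖W ξ‖ₑ ^ 2 = ‖∫ ξ, W ξ * (starRingEnd ℂ) (W ξ)‖ₑ := by
    have h1 := ofReal_integral_norm_eq_lintegral_enorm hWint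
    have h2 : ∫ ξ, W ξ * (starRingEnd ℂ) (W ξ) = ((∫ ξ, ‖W ξ * (starRingEnd ℂ) (W ξ)‖ : ℝ) : ℂ) := by
      rw [← integral_complex_ofReal]
      congr 1
      funext ξ
      rw [norm_mul, RCLike.norm_conj, Complex.mul_conj, Complex.normSq_eq_norm_sq, sq]
    rw [h2, ← ofReal_norm, Complex.norm_real, Real.norm_of_nonneg (by positivity), h1]
    refine lintegral_congr fun ξ => ?_
    rw [enorm_mul, sq, RCLike.enorm_conj]
  have e2 : ∫ ξ, W ξ * (starRingEnd ℂ) (W ξ) =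
      ∫ p : EuclideanSpace ℝ (Fin d) × EuclideanSpace ℝ (Fin d), ∫ ξ, Φ ξ p := by
    simp_rw [hWW]
    exact integral_integral_swap hΦint
  have e3 : ∀ p : EuclideanSpace ℝ (Fin d) × EuclideanSpace ℝ (Fin d), ∫ ξ, Φ ξ p =
      h p.1 * (starRingEnd ℂ) (h p.2) *
        ∫ ξ, k (p.1, ξ) * (starRingEnd ℂ) (k (p.2, ξ)) := fun p => by
    rw [← integral_const_mul]
    congr 1
    funext ξ
    simp only [Φ, map_mul]
    ring
  rw [e1, e2]
  refine (enorm_integral_le_lintegral_enorm _).trans ?_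
  refine le_trans (lintegral_mono fun p => ?_)
    (lintegral_lintegral_mul_mul_sub_le (H := fun x => ‖h x‖ₑ) hh.1.enorm hκ)
  rw [e3, enorm_mul, enorm_mul, RCLike.enorm_conj]
  gcongr
  exact hgram _ _

/-- Dual form of the `TT*` bound: Fubini moves the operator onto the test function `h`, and
Cauchy-Schwarz reduces to the transpose. -/
theorem lintegral_enorm_sq_le {k : EuclideanSpace ℝ (Fin d) × EuclideanSpace ℝ (Fin d) → ℂ}
    (hk : Continuous k) {B : ℝ} (hB : ∀ p, ‖k p‖ ≤ B) {S : Set (EuclideanSpace ℝ (Fin d))}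
    (hS : IsCompact S) (hkS : ∀ z, ∀ ξ ∉ S, k (z, ξ) = 0)
    {κ : EuclideanSpace ℝ (Fin d) → ℝ≥0∞} (hκ : Measurable κ)
    (hgram : ∀ z z', ‖∫ ξ, k (z, ξ) * (starRingEnd ℂ) (k (z', ξ))‖ₑ ≤ κ (z - z'))
    {u : EuclideanSpace ℝ (Fin d) → ℂ} (hu : Integrable u) :
    ∫⁻ z, ‖∫ ξ, k (z, ξ) * u ξ‖ₑ ^ 2 ≤ 2 * (∫⁻ x, κ x) * ∫⁻ x, ‖u x‖ₑ ^ 2 := by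
  have hF : Continuous fun z => ∫ ξ, k (z, ξ) * u ξ := by
    refine continuous_of_dominated (bound := fun ξ => B * ‖u ξ‖) (fun z => ?_) (fun z => ?_)
      (hu.norm.const_mul B) ?_
    · exact (hk.comp (by fun_prop)).aestronglyMeasurable.mul hu.1
    · refine Filter.Eventually.of_forall fun ξ => ?_
      rw [norm_mul]
      exact mul_le_mul_of_nonneg_right (hB _) (norm_nonneg _)
    · exact Filter.Eventually.of_forall fun ξ => (hk.comp (by fun_prop)).mul continuous_const
  refine lintegral_enorm_sq_le_of_dual hF fun h hh => ?_
  have hint : Integrable fun q : EuclideanSpace ℝ (Fin d) × EuclideanSpace ℝ (Fin d) =>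
      k q * (h q.1 * u q.2) :=
    (hh.mul_prod hu).bdd_mul hk.aestronglyMeasurable (Filter.Eventually.of_forall hB)
  have hswap : ∫ z, (∫ ξ, k (z, ξ) * u ξ) * h z = ∫ ξ, u ξ * ∫ z, k (z, ξ) * h z := by
    simp_rw [← integral_mul_const, ← integral_const_mul]
    rw [integral_integral_swap]
    · refine integral_congr_ae (Filter.Eventually.of_forall fun ξ => ?_)
      refine integral_congr_ae (Filter.Eventually.of_forall fun z => ?_)
      ring
    · refine hint.congr (Filter.Eventually.of_forall fun q => ?_)
      simp only [Function.uncurry]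
      ring
  rw [hswap]
  have hWm : AEStronglyMeasurable (fun ξ => ∫ z, k (z, ξ) * h z) := by
    have : AEStronglyMeasurable (fun q : EuclideanSpace ℝ (Fin d) × EuclideanSpace ℝ (Fin d) =>
        k (q.2, q.1) * h q.2) (volume.prod volume) :=
      (hk.comp (by fun_prop)).aestronglyMeasurable.mul hh.1.comp_snd
    exact this.integral_prod_right'
  refine (enorm_integral_mul_sq_le hu.1 hWm).trans ?_
  calc _ ≤ (∫⁻ x, ‖u x‖ₑ ^ 2) * (2 * (∫⁻ x, κ x) * ∫⁻ x, ‖h x‖ₑ ^ 2) := by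
        gcongr
        exact lintegral_enorm_sq_transpose_le hk hB hS hkS hκ hgram hh
    _ = _ := by ring

end Duality

/-! ### Square integrability of localized oscillatory integrals -/

section Packets

variable {d : ℕ}

/-- The localized oscillatory integrals
`∫ e^{iφ(z,ξ)} γ(ξ-ζ)² m(ζ,ξ) g(ξ) dξ` are square integrable in `(z, ζ)`. -/
theorem exists_lintegral_packet_le
    {φ : EuclideanSpace ℝ (Fin d) × EuclideanSpace ℝ (Fin d) → ℝ} (hφ : ContDiff ℝ ∞ φ)
    (hb : ∀ n i j, BddDerivs (prodBasis d) Set.univ n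
      fun (_ : Unit) => partialX i (partialXi j φ))
    {M : ℝ} (hM : ∀ z z' ξ, ‖z - z'‖ ≤ M * ‖gradXi φ (z, ξ) - gradXi φ (z', ξ)‖)
    {γ : EuclideanSpace ℝ (Fin d) → ℝ} (hγ : ContDiff ℝ ∞ γ) (hγs : HasCompactSupport γ) :
    ∃ A : ℝ≥0∞, A ≠ ⊤ ∧ ∀ (g : EuclideanSpace ℝ (Fin d) → ℂ)
      (m : EuclideanSpace ℝ (Fin d) → EuclideanSpace ℝ (Fin d) → ℂ), Integrable g →
      (∀ ζ, Continuous (m ζ)) → (∀ ζ ξ, ‖m ζ ξ‖ ≤ 1) →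
      ∫⁻ ζ, ∫⁻ z, ‖∫ ξ, Complex.exp (Complex.I * (φ (z, ξ) : ℂ)) * γ (ξ - ζ) *
        (γ (ξ - ζ) * m ζ ξ * g ξ)‖ₑ ^ 2 ≤ A * ∫⁻ ξ, ‖g ξ‖ₑ ^ 2 := by
  -- Order `d + 1` is the first integer order of decay that is integrable on `ℝᵈ`.
  obtain ⟨C, hC⟩ := exists_gram_bound hφ hb hM hγ hγs (d + 1)
  obtain ⟨B, hB⟩ := hγs.exists_bound_of_continuous hγ.continuous
  let κ : EuclideanSpace ℝ (Fin d) → ℝ≥0∞ := fun x =>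
    ENNReal.ofReal (C * (1 + ‖x‖) ^ (-((d + 1 : ℕ) : ℝ)))
  have hκm : Measurable κ := by
    refine ENNReal.measurable_ofReal.comp (Measurable.const_mul ?_ C)
    exact (measurable_const.add measurable_norm).pow_const _
  have hκ : ∫⁻ x, κ x ≠ ⊤ := by
    have h1 : Integrable fun x : EuclideanSpace ℝ (Fin d) =>
        C * (1 + ‖x‖) ^ (-((d + 1 : ℕ) : ℝ)) :=
      (integrable_one_add_norm (by simp)).const_mul C
    exact (lintegral_ofReal_le_lintegral_enorm _ |>.trans_lt h1.2).ne
  have hγ2 : ∫⁻ ξ, ‖γ ξ‖ₑ ^ 2 ≠ ⊤ := by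
    have h1 : Integrable fun ξ => γ ξ * γ ξ :=
      (hγ.continuous.mul hγ.continuous).integrable_of_hasCompactSupport hγs.mul_right
    have h2 : ∫⁻ ξ, ‖γ ξ * γ ξ‖ₑ ≠ ⊤ := h1.2.ne
    simp_rw [enorm_mul] at h2
    simpa only [sq] using h2
  refine ⟨2 * (∫⁻ x, κ x) * ∫⁻ ξ, ‖γ ξ‖ₑ ^ 2, by finiteness, fun g m hg hm hm1 => ?_⟩
  have hγc : ∀ ζ : EuclideanSpace ℝ (Fin d), Continuous fun ξ => (γ (ξ - ζ) : ℂ) := fun ζ =>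
    Complex.continuous_ofReal.comp (hγ.continuous.comp (by fun_prop))
  have hB0 : 0 ≤ B := (norm_nonneg _).trans (hB 0)
  -- For fixed `ζ`, one factor `γ(ξ-ζ)` belongs to the kernel and makes it compactly supported in
  -- `ξ`. The other stays with the input, so that the later integration over `ζ` converges.
  have step : ∀ ζ, ∫⁻ z, ‖∫ ξ, Complex.exp (Complex.I * (φ (z, ξ) : ℂ)) * γ (ξ - ζ) *
      (γ (ξ - ζ) * m ζ ξ * g ξ)‖ₑ ^ 2 ≤
        2 * (∫⁻ x, κ x) * ∫⁻ ξ, ‖γ (ξ - ζ)‖ₑ ^ 2 * ‖g ξ‖ₑ ^ 2 := fun ζ => by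
    have hu : Integrable fun ξ => γ (ξ - ζ) * m ζ ξ * g ξ := by
      refine hg.bdd_mul (c := B * 1) ((hγc ζ).mul (hm ζ)).aestronglyMeasurable
        (Filter.Eventually.of_forall fun ξ => ?_)
      rw [norm_mul, Complex.norm_real]
      exact mul_le_mul (hB _) (hm1 _ _) (norm_nonneg _) hB0
    refine (lintegral_enorm_sq_le
      (k := fun p => Complex.exp (Complex.I * (φ p : ℂ)) * γ (p.2 - ζ)) ?_ (B := B) (fun p => ?_)
      (S := (fun ξ => ξ + ζ) '' tsupport γ) (hγs.isCompact.image (by fun_prop)) ?_ hκm ?_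
      hu).trans ?_
    · exact (contDiff_cexp_I hφ).continuous.mul ((hγc ζ).comp continuous_snd)
    · rw [norm_mul, norm_cexp_I, one_mul, Complex.norm_real]
      exact hB _
    · intro z ξ hξ
      have : γ (ξ - ζ) = 0 := image_eq_zero_of_notMem_tsupport fun h => hξ ⟨_, h, by simp⟩
      simp [this]
    · intro z z'
      rw [← ofReal_norm]
      refine ENNReal.ofReal_le_ofReal (le_trans (le_of_eq ?_) (hC ζ z z'))
      congr 2
      funext ξ
      simp only [map_mul, ← Complex.exp_conj, Complex.conj_I, Complex.conj_ofReal]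
      rw [mul_mul_mul_comm, ← Complex.exp_add]
      push_cast
      ring_nf
    · gcongr with ξ
      rw [← mul_pow]
      gcongr
      rw [enorm_mul, enorm_mul]
      gcongr
      calc _ = ‖γ (ξ - ζ)‖ₑ * ‖m ζ ξ‖ₑ := by
            congr 1
            rw [← ofReal_norm, ← ofReal_norm, Complex.norm_real]
        _ ≤ ‖γ (ξ - ζ)‖ₑ * 1 := by
            gcongr
            rw [← ofReal_norm]
            exact ENNReal.ofReal_le_one.2 (hm1 _ _)
        _ = _ := mul_one _
  have hγm : Measurable fun ξ => ‖γ ξ‖ₑ ^ 2 := hγ.continuous.enorm.measurable.pow_const 2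
  refine (lintegral_mono step).trans (le_of_eq ?_)
  rw [lintegral_const_mul' _ _ (by finiteness), lintegral_lintegral_swap]
  · have h1 : ∀ ξ, ∫⁻ ζ, ‖γ (ξ - ζ)‖ₑ ^ 2 * ‖g ξ‖ₑ ^ 2 =
        (∫⁻ ζ, ‖γ ζ‖ₑ ^ 2) * ‖g ξ‖ₑ ^ 2 := fun ξ => by
      rw [lintegral_mul_const'' _ (f := fun ζ => ‖γ (ξ - ζ)‖ₑ ^ 2)
        (hγm.comp (measurable_const.sub measurable_id)).aemeasurable,
        lintegral_sub_left_eq_self (fun ζ => ‖γ ζ‖ₑ ^ 2) ξ]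
    simp_rw [h1]
    rw [lintegral_const_mul'' _ (hg.1.enorm.pow_const 2)]
    ring
  · exact (hγm.comp (measurable_snd.sub measurable_fst)).aemeasurable.mul
      (hg.1.enorm.comp_snd.pow_const 2)

end Packets

/-! ### Fourier representation with a uniform majorant -/

section FourierDecay

open scoped FourierTransform

variable {P ι V : Type*} [NormedAddCommGroup V] [InnerProductSpace ℝ V] [FiniteDimensional ℝ V]
  [MeasurableSpace V] [BorelSpace V] [Fintype ι]

/-- The Fourier transform is continuous on Schwartz space, so each seminorm of the transform is
controlled by finitely many seminorms of the function, uniformly over the family. -/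
theorem exists_pow_mul_norm_fourier_le {f : P → 𝓢(V, ℂ)}
    (hf : ∀ k n : ℕ, ∃ C : ℝ, ∀ p, SchwartzMap.seminorm ℝ k n (f p) ≤ C) (k : ℕ) :
    ∃ C : ℝ, ∀ p w, ‖w‖ ^ k * ‖𝓕 (f p) w‖ ≤ C := by
  let q : Seminorm ℝ 𝓢(V, ℂ) := (SchwartzMap.seminorm ℝ k 0).comp
    (FourierTransform.fourierCLM ℝ 𝓢(V, ℂ)).toLinearMap
  have hq : Continuous q :=
    ((schwartz_withSeminorms ℝ V ℂ).continuous_seminorm (k, 0)).comp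
      (FourierTransform.fourierCLM ℝ 𝓢(V, ℂ)).continuous
  obtain ⟨s, C, -, hC⟩ := Seminorm.bound_of_continuous (schwartz_withSeminorms ℝ V ℂ) q hq
  choose B hB using hf
  refine ⟨C * ∑ i ∈ s, |B i.1 i.2|, fun p w => ?_⟩
  calc ‖w‖ ^ k * ‖𝓕 (f p) w‖ = ‖w‖ ^ k * ‖iteratedFDeriv ℝ 0 (⇑(𝓕 (f p) : 𝓢(V, ℂ))) w‖ := by simp
    _ ≤ q (f p) := SchwartzMap.le_seminorm ℝ k 0 (𝓕 (f p)) w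
    _ ≤ C * s.sup (schwartzSeminormFamily ℝ V ℂ) (f p) := hC (f p)
    _ ≤ _ := by
      gcongr
      refine Seminorm.finset_sup_apply_le (by positivity) fun i hi => ?_
      calc _ ≤ B i.1 i.2 := hB i.1 i.2 p
        _ ≤ |B i.1 i.2| := le_abs_self _
        _ ≤ _ := Finset.single_le_sum (f := fun i : ℕ × ℕ => |B i.1 i.2|)
          (fun _ _ => abs_nonneg _) hi

/-- A family of smooth functions with uniform support and uniformly bounded derivatives has a
Fourier representation with an integrable majorant. -/
theorem exists_fourier_representation (b : Module.Basis ι ℝ V) {f : P → V → ℂ}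
    (hf : ∀ p, ContDiff ℝ ∞ (f p)) (hfb : ∀ n, BddDerivs b Set.univ n f) {R : ℝ}
    (hfR : ∀ p, ∀ w ∉ Metric.closedBall (0 : V) R, f p w = 0) :
    ∃ M : V → ℝ, Integrable M ∧ ∀ p, ∃ c : V → ℂ, Continuous c ∧ (∀ w, ‖c w‖ ≤ M w) ∧
      ∀ v, f p v = ∫ w, c w * Complex.exp (Complex.I * ((2 * Real.pi * inner ℝ w v : ℝ) : ℂ)) := by
  have hcs : ∀ p, HasCompactSupport (f p) := fun p =>
    HasCompactSupport.intro (isCompact_closedBall 0 R) (hfR p)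
  let F : P → 𝓢(V, ℂ) := fun p => (hcs p).toSchwartzMap (hf p)
  have hF : ∀ k n : ℕ, ∃ C : ℝ, ∀ p, SchwartzMap.seminorm ℝ k n (F p) ≤ C := fun k n => by
    obtain ⟨C, hC⟩ := (hfb n).norm_iteratedFDeriv_le b hf
    refine ⟨|R| ^ k * |C|, fun p => SchwartzMap.seminorm_le_bound ℝ k n _ (by positivity)
      fun w => ?_⟩
    change ‖w‖ ^ k * ‖iteratedFDeriv ℝ n (f p) w‖ ≤ _
    by_cases hw : w ∈ Metric.closedBall (0 : V) R
    · have h1 : ‖w‖ ≤ R := by simpa using hw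
      gcongr
      · exact h1.trans (le_abs_self R)
      · exact (hC p w (Set.mem_univ w)).trans (le_abs_self C)
    · have h1 : iteratedFDeriv ℝ n (f p) w = 0 := by
        by_contra hne
        have h2 := support_iteratedFDeriv_subset (𝕜 := ℝ) n (Function.mem_support.2 hne)
        refine hw (closure_minimal (fun x hx => ?_) Metric.isClosed_closedBall h2)
        by_contra hx'
        exact hx (hfR p x hx')
      rw [h1, norm_zero, mul_zero]
      positivity
  -- Decay of order `dim V + 1` is integrable. The bounds with weights 1 and `|w|^K` are combined
  -- through `(1+t)^K ≤ 2^(K-1) (1+t^K)`.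
  set K : ℕ := Module.finrank ℝ V + 1 with hK
  obtain ⟨C₀, hC₀⟩ := exists_pow_mul_norm_fourier_le hF 0
  obtain ⟨C₁, hC₁⟩ := exists_pow_mul_norm_fourier_le hF K
  refine ⟨fun w => 2 ^ (K - 1) * (C₀ + C₁) * (1 + ‖w‖) ^ (-(K : ℝ)),
    (integrable_one_add_norm (by simp [hK])).const_mul _, fun p => ⟨⇑(𝓕 (F p) : 𝓢(V, ℂ)),
    (𝓕 (F p)).continuous, fun w => ?_, fun v => ?_⟩⟩
  · have h0 : (0 : ℝ) < 1 + ‖w‖ := by positivity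
    beta_reduce
    rw [Real.rpow_neg h0.le, Real.rpow_natCast, ← div_eq_mul_inv, le_div_iff₀ (by positivity)]
    have h1 := hC₀ p w
    have h2 := hC₁ p w
    have h3 := add_pow_le zero_le_one (norm_nonneg w) K
    calc _ ≤ ‖𝓕 (F p) w‖ * (2 ^ (K - 1) * (1 ^ K + ‖w‖ ^ K)) := by gcongr
      _ = 2 ^ (K - 1) * (‖w‖ ^ 0 * ‖𝓕 (F p) w‖ + ‖w‖ ^ K * ‖𝓕 (F p) w‖) := by ring
      _ ≤ _ := by gcongr
  · have h1 : f p v = 𝓕⁻ (𝓕 (F p)) v := by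
      rw [FourierTransform.fourierInv_fourier_eq]
      rfl
    rw [h1, SchwartzMap.fourierInv_coe, Real.fourierInv_eq']
    refine integral_congr_ae (Filter.Eventually.of_forall fun w => ?_)
    simp only [smul_eq_mul]
    rw [mul_comm, mul_comm Complex.I]

end FourierDecay

/-! ### Expansion of the kernel on phase space cells -/

section BddDerivsSupport

variable {P ι W F : Type*} [NormedAddCommGroup W] [NormedSpace ℝ W]
  [NormedAddCommGroup F] [NormedSpace ℝ F]

/-- Off the closed set `S` the functions vanish on an open set, hence so do their derivatives.
Bounds valid only on a ball thus become global after cutting off. -/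
theorem BddDerivs.univ_of_support {v : ι → W} {S : Set W} (hS : IsClosed S) {n : ℕ}
    {f : P → W → F} (h : BddDerivs v S n f) (hf : ∀ p, ∀ w ∉ S, f p w = 0) :
    BddDerivs v Set.univ n f := by
  have key : ∀ {f : P → W → F}, (∀ p, ∀ w ∉ S, f p w = 0) →
      (∃ C : ℝ, ∀ p, ∀ w ∈ S, ‖f p w‖ ≤ C) → ∃ C : ℝ, ∀ p, ∀ w ∈ Set.univ, ‖f p w‖ ≤ C := by
    rintro f hf ⟨C, hC⟩
    refine ⟨|C|, fun p w _ => ?_⟩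
    by_cases hw : w ∈ S
    · exact (hC p w hw).trans (le_abs_self C)
    · rw [hf p w hw, norm_zero]; positivity
  induction n generalizing f with
  | zero => exact key hf h
  | succ n ih =>
    refine ⟨key hf h.1, fun i => ih (h.2 i) fun p w hw => ?_⟩
    have : f p =ᶠ[nhds w] fun _ => 0 := by
      filter_upwards [hS.isOpen_compl.mem_nhds hw] with w' hw'
      exact hf p w' hw'
    rw [this.fderiv_eq]
    simp

end BddDerivsSupport

section Expansion

variable {d : ℕ}

/-- The projection `(x, ξ) ↦ (x, 0)`. -/
noncomputable def projX (d : ℕ) : EuclideanSpace ℝ (Fin d) × EuclideanSpace ℝ (Fin d) →L[ℝ]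
    EuclideanSpace ℝ (Fin d) × EuclideanSpace ℝ (Fin d) :=
  (ContinuousLinearMap.inl ℝ _ _).comp (ContinuousLinearMap.fst ℝ _ _)

/-- The projection `(x, ξ) ↦ (0, ξ)`. -/
noncomputable def projXi (d : ℕ) : EuclideanSpace ℝ (Fin d) × EuclideanSpace ℝ (Fin d) →L[ℝ]
    EuclideanSpace ℝ (Fin d) × EuclideanSpace ℝ (Fin d) :=
  (ContinuousLinearMap.inr ℝ _ _).comp (ContinuousLinearMap.snd ℝ _ _)

/-- The mixed second difference of `φ` at `w₀`. -/
noncomputable def mixedDiff (φ : EuclideanSpace ℝ (Fin d) × EuclideanSpace ℝ (Fin d) → ℝ)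
    (w₀ w : EuclideanSpace ℝ (Fin d) × EuclideanSpace ℝ (Fin d)) : ℝ :=
  φ (w₀ + w) - φ (w₀ + projX d w) - φ (w₀ + projXi d w) + φ w₀

theorem contDiff_mixedDiff {φ : EuclideanSpace ℝ (Fin d) × EuclideanSpace ℝ (Fin d) → ℝ}
    (hφ : ContDiff ℝ ∞ φ) (w₀ : EuclideanSpace ℝ (Fin d) × EuclideanSpace ℝ (Fin d)) :
    ContDiff ℝ ∞ (mixedDiff φ w₀) :=
  (((hφ.comp (contDiff_const.add contDiff_id)).sub
    (hφ.comp (contDiff_const.add (projX d).contDiff))).sub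
    (hφ.comp (contDiff_const.add (projXi d).contDiff))).add contDiff_const

/-- An `x`-derivative of the mixed difference is a difference of values of `∂_x φ` at points
differing only in `ξ`, hence is controlled by the mixed derivatives of `φ`; similarly for a
`ξ`-derivative. The growth of `φ'` at the base point cancels. -/
theorem bddDerivs_fderiv_mixedDiff
    {φ : EuclideanSpace ℝ (Fin d) × EuclideanSpace ℝ (Fin d) → ℝ} (hφ : ContDiff ℝ ∞ φ)
    (hb : ∀ n i j, BddDerivs (prodBasis d) Set.univ n
      fun (_ : Unit) => partialX i (partialXi j φ)) (R : ℝ) (n : ℕ) (k : Fin d ⊕ Fin d) :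
    BddDerivs (prodBasis d) (Metric.closedBall 0 R) n
      fun w₀ w => fderiv ℝ (mixedDiff φ w₀) w (prodBasis d k) := by
  have hd : ∀ w₀ w, HasFDerivAt (mixedDiff φ w₀) (fderiv ℝ φ (w₀ + w) -
      (fderiv ℝ φ (w₀ + projX d w)).comp (projX d) -
      (fderiv ℝ φ (w₀ + projXi d w)).comp (projXi d)) w := fun w₀ w => by
    refine HasFDerivAt.add_const _ (HasFDerivAt.sub (HasFDerivAt.sub ?_ ?_) ?_)
    · exact (hφ.differentiable (by simp) _).hasFDerivAt.comp w ((hasFDerivAt_id w).const_add w₀)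
    · exact (hφ.differentiable (by simp) _).hasFDerivAt.comp w
        ((projX d).hasFDerivAt.const_add w₀)
    · exact (hφ.differentiable (by simp) _).hasFDerivAt.comp w
        ((projXi d).hasFDerivAt.const_add w₀)
  rcases k with i | j
  · refine (BddDerivs.sub_comp_proj (prodBasis d) (projX d) (Set.range Sum.inr) ?_ ?_ R
      (contDiff_partialX hφ i) ?_).congr fun w₀ w => ?_
    · rintro _ ⟨j, rfl⟩
      simp [projX]
    · rintro (j | j) hj
      · simp [projX]
      · exact absurd ⟨j, rfl⟩ hj
    · rintro _ ⟨j, rfl⟩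
      refine (hb n i j).congr fun _ w => ?_
      rw [prodBasis_inr]
      exact fderiv_fderiv_comm hφ _ _ w
    · rw [(hd w₀ w).fderiv]
      simp only [projX, projXi, partialX, prodBasis_inl, sub_apply, ContinuousLinearMap.comp_apply,
        ContinuousLinearMap.coe_fst', ContinuousLinearMap.coe_snd', ContinuousLinearMap.inl_apply,
        ContinuousLinearMap.inr_apply]
      rw [show ((0, 0) : EuclideanSpace ℝ (Fin d) × EuclideanSpace ℝ (Fin d)) = 0 from rfl,
        map_zero, sub_zero]
  · refine (BddDerivs.sub_comp_proj (prodBasis d) (projXi d) (Set.range Sum.inl) ?_ ?_ R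
      (contDiff_partialXi hφ j) ?_).congr fun w₀ w => ?_
    · rintro _ ⟨i, rfl⟩
      simp [projXi]
    · rintro (i | i) hi
      · exact absurd ⟨i, rfl⟩ hi
      · simp [projXi]
    · rintro _ ⟨i, rfl⟩
      refine (hb n i j).congr fun _ w => ?_
      rw [prodBasis_inl]
      rfl
    · rw [(hd w₀ w).fderiv]
      simp only [projX, projXi, partialXi, prodBasis_inr, sub_apply, ContinuousLinearMap.comp_apply,
        ContinuousLinearMap.coe_fst', ContinuousLinearMap.coe_snd', ContinuousLinearMap.inl_apply,
        ContinuousLinearMap.inr_apply]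
      rw [show ((0, 0) : EuclideanSpace ℝ (Fin d) × EuclideanSpace ℝ (Fin d)) = 0 from rfl,
        map_zero, sub_zero]

/-- The plain product carries the supremum norm, so the Fourier representation is taken on the
`WithLp 2` product, an inner product space, and transported back. -/
theorem exists_fourier_representation_prod {P : Type*}
    {f : P → EuclideanSpace ℝ (Fin d) × EuclideanSpace ℝ (Fin d) → ℂ}
    (hf : ∀ p, ContDiff ℝ ∞ (f p)) (hfb : ∀ n, BddDerivs (prodBasis d) Set.univ n f) {R : ℝ}
    (hfR : ∀ p, ∀ w ∉ Metric.closedBall 0 R, f p w = 0) :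
    ∃ M : WithLp 2 (EuclideanSpace ℝ (Fin d) × EuclideanSpace ℝ (Fin d)) → ℝ, Integrable M ∧
      ∀ p, ∃ c : WithLp 2 (EuclideanSpace ℝ (Fin d) × EuclideanSpace ℝ (Fin d)) → ℂ,
        Continuous c ∧ (∀ w, ‖c w‖ ≤ M w) ∧ ∀ v, f p v =
          ∫ w, c w * (Complex.exp (Complex.I * ((2 * Real.pi * inner ℝ w.fst v.1 : ℝ) : ℂ)) *
            Complex.exp (Complex.I * ((2 * Real.pi * inner ℝ w.snd v.2 : ℝ) : ℂ))) := by
  let L := WithLp.prodContinuousLinearEquiv 2 ℝ (EuclideanSpace ℝ (Fin d))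
    (EuclideanSpace ℝ (Fin d))
  obtain ⟨K, hK⟩ : ∃ K : ℝ, ∀ w, ‖L.symm w‖ ≤ K * ‖w‖ :=
    ⟨_, fun w => L.symm.toContinuousLinearMap.le_opNorm w⟩
  let bV := (prodBasis d).map L.symm.toLinearEquiv
  have hbV : ∀ n, BddDerivs bV Set.univ n fun p v => f p (L v) := fun n =>
    (BddDerivs.comp_affine (L : _ →L[ℝ] _) id (fun k => by simp [bV]) (fun _ => 0) hf (hfb n)
      _).congr fun p v => by simp
  obtain ⟨M, hM, h⟩ := exists_fourier_representation bV (fun p => (hf p).comp L.contDiff) hbV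
    (R := |K| * |R|) fun p v hv => hfR p _ fun h => hv (by
      simp only [Metric.mem_closedBall, dist_zero_right] at h ⊢
      calc ‖v‖ = ‖L.symm (L v)‖ := by simp
        _ ≤ K * ‖L v‖ := hK _
        _ ≤ |K| * |R| := mul_le_mul (le_abs_self K) (h.trans (le_abs_self R)) (norm_nonneg _)
          (abs_nonneg K))
  refine ⟨M, hM, fun p => ?_⟩
  obtain ⟨c, hc, hcM, hc'⟩ := h p
  refine ⟨c, hc, hcM, fun v => ?_⟩
  have h1 := hc' (L.symm v)
  have h2 : L (L.symm v) = v := L.apply_symm_apply v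
  rw [Function.comp_apply, h2] at h1
  rw [h1]
  refine integral_congr_ae (Filter.Eventually.of_forall fun w => ?_)
  beta_reduce
  rw [← Complex.exp_add, WithLp.prod_inner_apply]
  congr 2
  change _ * ((2 * Real.pi * (inner ℝ w.fst v.1 + inner ℝ w.snd v.2) : ℝ) : ℂ) = _
  push_cast
  ring

/-- On unit cells the kernel `a e^{iφ}` is, after splitting off the phases `φ(x,ζ)` and `φ(z,ξ)`,
a superposition of products of characters, with a majorant independent of the cell. -/
theorem exists_packet_expansion
    {φ : EuclideanSpace ℝ (Fin d) × EuclideanSpace ℝ (Fin d) → ℝ} (hφ : ContDiff ℝ ∞ φ)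
    (hb : ∀ n i j, BddDerivs (prodBasis d) Set.univ n
      fun (_ : Unit) => partialX i (partialXi j φ))
    {a : EuclideanSpace ℝ (Fin d) × EuclideanSpace ℝ (Fin d) → ℂ} (ha : ContDiff ℝ ∞ a)
    (hab : ∀ n, BddDerivs (prodBasis d) Set.univ n fun (_ : Unit) => a)
    {γ : EuclideanSpace ℝ (Fin d) → ℝ} (hγ : ContDiff ℝ ∞ γ) (hγs : HasCompactSupport γ) :
    ∃ M : WithLp 2 (EuclideanSpace ℝ (Fin d) × EuclideanSpace ℝ (Fin d)) → ℝ, Integrable M ∧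
      ∀ w₀ : EuclideanSpace ℝ (Fin d) × EuclideanSpace ℝ (Fin d),
      ∃ c : WithLp 2 (EuclideanSpace ℝ (Fin d) × EuclideanSpace ℝ (Fin d)) → ℂ, Continuous c ∧
        (∀ w, ‖c w‖ ≤ M w) ∧ ∀ x ξ, γ x * γ ξ * a (w₀ + (x, ξ)) *
          Complex.exp (Complex.I * (mixedDiff φ w₀ (x, ξ) : ℂ)) =
        ∫ w, c w * (Complex.exp (Complex.I * ((2 * Real.pi * inner ℝ w.fst x : ℝ) : ℂ)) *
          Complex.exp (Complex.I * ((2 * Real.pi * inner ℝ w.snd ξ : ℝ) : ℂ))) := by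
  obtain ⟨R, hR⟩ : ∃ R, ∀ ξ ∉ Metric.closedBall (0 : EuclideanSpace ℝ (Fin d)) R, γ ξ = 0 := by
    obtain ⟨R, hR⟩ := hγs.isCompact.isBounded.subset_closedBall (0 : EuclideanSpace ℝ (Fin d))
    exact ⟨R, fun ξ hξ => image_eq_zero_of_notMem_tsupport fun h => hξ (hR h)⟩
  let W := EuclideanSpace ℝ (Fin d) × EuclideanSpace ℝ (Fin d)
  let f : W → W → ℂ := fun w₀ w => (γ w.1 : ℂ) * (γ w.2 : ℂ) * a (w₀ + w) *
    Complex.exp (Complex.I * (mixedDiff φ w₀ w : ℂ))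
  have hg : ContDiff ℝ ∞ fun w : W => γ w.1 * γ w.2 :=
    (hγ.comp contDiff_fst).mul (hγ.comp contDiff_snd)
  have hg0 : ∀ w ∉ Metric.closedBall (0 : W) R, γ w.1 * γ w.2 = 0 := fun w hw => by
    by_contra h
    have h1 : w.1 ∈ Metric.closedBall (0 : EuclideanSpace ℝ (Fin d)) R := by
      by_contra h1; exact h (by rw [hR _ h1, zero_mul])
    have h2 : w.2 ∈ Metric.closedBall (0 : EuclideanSpace ℝ (Fin d)) R := by
      by_contra h2; exact h (by rw [hR _ h2, mul_zero])
    refine hw ?_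
    simp only [Metric.mem_closedBall, dist_zero_right] at h1 h2 ⊢
    exact max_le h1 h2
  have hgs : HasCompactSupport fun w : W => γ w.1 * γ w.2 :=
    HasCompactSupport.intro (isCompact_closedBall 0 R) hg0
  have hgC : ContDiff ℝ ∞ fun w : W => (γ w.1 : ℂ) * (γ w.2 : ℂ) := by
    have h := Complex.ofRealCLM.contDiff.comp hg
    simpa only [Function.comp_def, Complex.ofRealCLM_apply, Complex.ofReal_mul] using h
  have haw : ∀ w₀ : W, ContDiff ℝ ∞ fun w => a (w₀ + w) := fun w₀ =>
    ha.comp (contDiff_const.add contDiff_id)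
  have he : ∀ w₀ : W, ContDiff ℝ ∞ fun w => Complex.exp (Complex.I * (mixedDiff φ w₀ w : ℂ)) :=
    fun w₀ => contDiff_cexp_I (contDiff_mixedDiff hφ w₀)
  have hf : ∀ w₀, ContDiff ℝ ∞ (f w₀) := fun w₀ => (hgC.mul (haw w₀)).mul (he w₀)
  have hf0 : ∀ w₀, ∀ w ∉ Metric.closedBall (0 : W) R, f w₀ w = 0 := fun w₀ w hw => by
    have : (γ w.1 : ℂ) * (γ w.2 : ℂ) = 0 := by exact_mod_cast hg0 w hw
    simp [f, this]
  have hfb : ∀ n, BddDerivs (prodBasis d) Set.univ n f := fun n => by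
    refine BddDerivs.univ_of_support (S := Metric.closedBall 0 R) Metric.isClosed_closedBall
      ?_ hf0
    refine .mul (fun w₀ => hgC.mul (haw w₀)) he (.mul (fun _ => hgC) haw ?_ ?_) ?_
    · refine (BddDerivs.ofReal (fun _ => hg) ((BddDerivs.of_hasCompactSupport hg hgs).reparam
        fun _ : W => ())).congr fun _ w => ?_
      push_cast
      rfl
    · exact BddDerivs.comp_affine (v := prodBasis d) (v' := prodBasis d)
        (ContinuousLinearMap.id ℝ W) id (fun _ => rfl) id (fun _ => ha)
        ((hab n).reparam fun _ : W => ()) _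
    -- The mixed difference has bounded derivatives only for `w` in a ball, which is why the
    -- estimate is made on the support of the cutoff.
    · exact .cexp_I (contDiff_mixedDiff hφ) fun k => bddDerivs_fderiv_mixedDiff hφ hb R n k
  obtain ⟨M, hM, h⟩ := exists_fourier_representation_prod hf hfb hf0
  refine ⟨M, hM, fun w₀ => ?_⟩
  obtain ⟨c, hc, hcM, hc'⟩ := h w₀
  exact ⟨c, hc, hcM, fun x ξ => hc' (x, ξ)⟩

end Expansion

/-! ### Exchange of the variables `x` and `ξ` -/

section Swap

variable {d : ℕ} {F : Type*} [NormedAddCommGroup F] [NormedSpace ℝ F]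

theorem partialX_comp_swap {f : EuclideanSpace ℝ (Fin d) × EuclideanSpace ℝ (Fin d) → F}
    (hf : ContDiff ℝ ∞ f) (i : Fin d)
    (p : EuclideanSpace ℝ (Fin d) × EuclideanSpace ℝ (Fin d)) :
    partialX i (fun q => f q.swap) p = partialXi i f p.swap := by
  have h := (hf.differentiable (by simp) p.swap).hasFDerivAt.comp p
    (ContinuousLinearEquiv.prodComm ℝ (EuclideanSpace ℝ (Fin d))
      (EuclideanSpace ℝ (Fin d))).hasFDerivAt
  exact congrArg (fun l => l (EuclideanSpace.single i 1, 0)) h.fderiv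

theorem partialXi_comp_swap {f : EuclideanSpace ℝ (Fin d) × EuclideanSpace ℝ (Fin d) → F}
    (hf : ContDiff ℝ ∞ f) (i : Fin d)
    (p : EuclideanSpace ℝ (Fin d) × EuclideanSpace ℝ (Fin d)) :
    partialXi i (fun q => f q.swap) p = partialX i f p.swap := by
  have h := (hf.differentiable (by simp) p.swap).hasFDerivAt.comp p
    (ContinuousLinearEquiv.prodComm ℝ (EuclideanSpace ℝ (Fin d))
      (EuclideanSpace ℝ (Fin d))).hasFDerivAt
  exact congrArg (fun l => l (0, EuclideanSpace.single i 1)) h.fderiv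

theorem contDiff_comp_swap {f : EuclideanSpace ℝ (Fin d) × EuclideanSpace ℝ (Fin d) → F}
    (hf : ContDiff ℝ ∞ f) : ContDiff ℝ ∞ fun q : EuclideanSpace ℝ (Fin d) × EuclideanSpace ℝ (Fin d) => f q.swap :=
  hf.comp (contDiff_snd.prodMk contDiff_fst)

theorem bddDerivs_mixed_comp_swap
    {φ : EuclideanSpace ℝ (Fin d) × EuclideanSpace ℝ (Fin d) → F} (hφ : ContDiff ℝ ∞ φ) {n : ℕ}
    (i j : Fin d)
    (hb : BddDerivs (prodBasis d) Set.univ n fun (_ : Unit) => partialX j (partialXi i φ)) :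
    BddDerivs (prodBasis d) Set.univ n
      fun (_ : Unit) => partialX i (partialXi j fun q => φ q.swap) := by
  have h := BddDerivs.comp_affine (v := prodBasis d) (v' := prodBasis d)
    (ContinuousLinearEquiv.prodComm ℝ (EuclideanSpace ℝ (Fin d))
      (EuclideanSpace ℝ (Fin d))).toContinuousLinearMap Sum.swap
    (by rintro (k | k) <;> simp) (fun _ : Unit => 0)
    (fun _ => contDiff_partialX (contDiff_partialXi hφ i) j) hb Set.univ
  refine h.congr fun _ p => ?_
  rw [zero_add, show (partialXi j fun q => φ q.swap) = fun q => partialX j φ q.swap from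
    funext (partialXi_comp_swap hφ j), partialX_comp_swap (contDiff_partialX hφ j)]
  exact fderiv_fderiv_comm hφ _ _ _

theorem gradXi_comp_swap {φ : EuclideanSpace ℝ (Fin d) × EuclideanSpace ℝ (Fin d) → ℝ}
    (hφ : ContDiff ℝ ∞ φ) (p : EuclideanSpace ℝ (Fin d) × EuclideanSpace ℝ (Fin d)) :
    gradXi (fun q => φ q.swap) p = gradX φ p.swap := by
  ext i
  exact partialXi_comp_swap hφ i p

end Swap

/-! ### Wave packets and separation of variables -/

section Packet

variable {d : ℕ}

/-- The wave packet `e^{iφ(z,ξ)} γ(ξ-ζ)² e^{2πi⟨q,ξ-ζ⟩}`. -/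
noncomputable def packetKernel (φ : EuclideanSpace ℝ (Fin d) × EuclideanSpace ℝ (Fin d) → ℝ)
    (γ : EuclideanSpace ℝ (Fin d) → ℝ) (q z ζ ξ : EuclideanSpace ℝ (Fin d)) : ℂ :=
  Complex.exp (Complex.I * (φ (z, ξ) : ℂ)) * γ (ξ - ζ) *
    (γ (ξ - ζ) * Complex.exp (Complex.I * ((2 * Real.pi * inner ℝ q (ξ - ζ) : ℝ) : ℂ)))

/-- The wave packet coefficients of `g`. -/
noncomputable def packet (φ : EuclideanSpace ℝ (Fin d) × EuclideanSpace ℝ (Fin d) → ℝ)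
    (γ : EuclideanSpace ℝ (Fin d) → ℝ) (g : EuclideanSpace ℝ (Fin d) → ℂ)
    (q z ζ : EuclideanSpace ℝ (Fin d)) : ℂ :=
  ∫ ξ, packetKernel φ γ q z ζ ξ * g ξ

theorem continuous_packetKernel {X : Type*} [TopologicalSpace X]
    {φ : EuclideanSpace ℝ (Fin d) × EuclideanSpace ℝ (Fin d) → ℝ}
    (hφ : Continuous φ) {γ : EuclideanSpace ℝ (Fin d) → ℝ} (hγ : Continuous γ)
    {q z ζ ξ : X → EuclideanSpace ℝ (Fin d)} (hq : Continuous q) (hz : Continuous z)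
    (hζ : Continuous ζ) (hξ : Continuous ξ) :
    Continuous fun t => packetKernel φ γ (q t) (z t) (ζ t) (ξ t) := by
  unfold packetKernel
  fun_prop

theorem norm_packetKernel_le {φ : EuclideanSpace ℝ (Fin d) × EuclideanSpace ℝ (Fin d) → ℝ}
    {γ : EuclideanSpace ℝ (Fin d) → ℝ} {B : ℝ} (hB : ∀ x, ‖γ x‖ ≤ B)
    (q z ζ ξ : EuclideanSpace ℝ (Fin d)) : ‖packetKernel φ γ q z ζ ξ‖ ≤ B * B := by
  have hB0 : 0 ≤ B := (norm_nonneg _).trans (hB 0)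
  simp only [packetKernel, norm_mul, norm_cexp_I, one_mul, mul_one, Complex.norm_real]
  gcongr <;> exact hB _

/-- Joint continuity supplies the measurability needed for Tonelli and Cauchy-Schwarz in phase
space. -/
theorem continuous_packet {X : Type*} [TopologicalSpace X] [FirstCountableTopology X]
    {φ : EuclideanSpace ℝ (Fin d) × EuclideanSpace ℝ (Fin d) → ℝ}
    (hφ : Continuous φ) {γ : EuclideanSpace ℝ (Fin d) → ℝ} (hγ : Continuous γ)
    (hγs : HasCompactSupport γ) {g : EuclideanSpace ℝ (Fin d) → ℂ} (hg : Integrable g)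
    {q z ζ : X → EuclideanSpace ℝ (Fin d)} (hq : Continuous q) (hz : Continuous z)
    (hζ : Continuous ζ) : Continuous fun t => packet φ γ g (q t) (z t) (ζ t) := by
  obtain ⟨B, hB⟩ := hγs.exists_bound_of_continuous hγ
  refine continuous_of_dominated (bound := fun ξ => B * B * ‖g ξ‖) (fun t => ?_) (fun t => ?_)
    (hg.norm.const_mul _) (Filter.Eventually.of_forall fun ξ => ?_)
  · exact (continuous_packetKernel hφ hγ continuous_const continuous_const continuous_const
      continuous_id).aestronglyMeasurable.mul hg.1
  · refine Filter.Eventually.of_forall fun ξ => ?_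
    rw [norm_mul]
    exact mul_le_mul_of_nonneg_right (norm_packetKernel_le hB _ _ _ _) (norm_nonneg _)
  · exact (continuous_packetKernel hφ hγ hq hz hζ continuous_const).mul continuous_const

/-- The modulation by `q` has modulus one and can be absorbed into the multiplier `m`, so `A` does
not depend on `q`. -/
theorem exists_lintegral_packet_sq_le
    {φ : EuclideanSpace ℝ (Fin d) × EuclideanSpace ℝ (Fin d) → ℝ} (hφ : ContDiff ℝ ∞ φ)
    (hb : ∀ n i j, BddDerivs (prodBasis d) Set.univ n
      fun (_ : Unit) => partialX i (partialXi j φ))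
    {M : ℝ} (hM : ∀ z z' ξ, ‖z - z'‖ ≤ M * ‖gradXi φ (z, ξ) - gradXi φ (z', ξ)‖)
    {γ : EuclideanSpace ℝ (Fin d) → ℝ} (hγ : ContDiff ℝ ∞ γ) (hγs : HasCompactSupport γ) :
    ∃ A : ℝ≥0∞, A ≠ ⊤ ∧ ∀ g : EuclideanSpace ℝ (Fin d) → ℂ, Integrable g → ∀ q,
      ∫⁻ ζ, ∫⁻ z, ‖packet φ γ g q z ζ‖ₑ ^ 2 ≤ A * ∫⁻ ξ, ‖g ξ‖ₑ ^ 2 := by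
  obtain ⟨A, hA, h⟩ := exists_lintegral_packet_le hφ hb hM hγ hγs
  refine ⟨A, hA, fun g hg q => le_trans (le_of_eq ?_) (h g (fun ζ ξ =>
    Complex.exp (Complex.I * ((2 * Real.pi * inner ℝ q (ξ - ζ) : ℝ) : ℂ))) hg
    (fun ζ => by fun_prop) (fun ζ ξ => (norm_cexp_I _).le))⟩
  simp only [packet, packetKernel, mul_assoc]

/-- The localization to a cell in phase space, expressed through wave packets. -/
theorem localized_kernel_eq {φ : EuclideanSpace ℝ (Fin d) × EuclideanSpace ℝ (Fin d) → ℝ}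
    {a : EuclideanSpace ℝ (Fin d) × EuclideanSpace ℝ (Fin d) → ℂ}
    {γ : EuclideanSpace ℝ (Fin d) → ℝ}
    {w₀ : EuclideanSpace ℝ (Fin d) × EuclideanSpace ℝ (Fin d)}
    {c : WithLp 2 (EuclideanSpace ℝ (Fin d) × EuclideanSpace ℝ (Fin d)) → ℂ}
    (hc : ∀ x ξ, γ x * γ ξ * a (w₀ + (x, ξ)) *
          Complex.exp (Complex.I * (mixedDiff φ w₀ (x, ξ) : ℂ)) =
        ∫ w, c w * (Complex.exp (Complex.I * ((2 * Real.pi * inner ℝ w.fst x : ℝ) : ℂ)) *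
          Complex.exp (Complex.I * ((2 * Real.pi * inner ℝ w.snd ξ : ℝ) : ℂ))))
    (b : ℂ) (p : EuclideanSpace ℝ (Fin d) × EuclideanSpace ℝ (Fin d)) :
    Complex.exp (Complex.I * (φ p : ℂ)) * a p * b *
      (((γ (p.1 - w₀.1) ^ 3 : ℝ) : ℂ) * ((γ (p.2 - w₀.2) ^ 3 : ℝ) : ℂ)) =
    Complex.exp (Complex.I * ((-φ w₀ : ℝ) : ℂ)) *
      ∫ w, (packetKernel (fun q => φ q.swap) γ w.fst w₀.2 w₀.1 p.1 *
        packetKernel φ γ w.snd w₀.1 w₀.2 p.2) * (b * c w) := by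
  have h1 : ∀ w : WithLp 2 (EuclideanSpace ℝ (Fin d) × EuclideanSpace ℝ (Fin d)),
      (packetKernel (fun q => φ q.swap) γ w.fst w₀.2 w₀.1 p.1 *
        packetKernel φ γ w.snd w₀.1 w₀.2 p.2) * (b * c w) =
      (Complex.exp (Complex.I * (φ (p.1, w₀.2) : ℂ)) *
        Complex.exp (Complex.I * (φ (w₀.1, p.2) : ℂ)) * γ (p.1 - w₀.1) ^ 2 *
        γ (p.2 - w₀.2) ^ 2 * b) * (c w *
        (Complex.exp (Complex.I * ((2 * Real.pi * inner ℝ w.fst (p.1 - w₀.1) : ℝ) : ℂ)) *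
          Complex.exp (Complex.I * ((2 * Real.pi * inner ℝ w.snd (p.2 - w₀.2) : ℝ) : ℂ)))) :=
    fun w => by
      simp only [packetKernel, Prod.swap_prod_mk]
      ring
  have e1 : w₀ + (p.1 - w₀.1, p.2 - w₀.2) = p := by ext1 <;> simp
  -- The definition of `mixedDiff` solved for `φ p`. Of the three factors `γ` in each variable, two
  -- belong to the packets and one to the function expanded in `hc`.
  have h2 : Complex.exp (Complex.I * ((-φ w₀ : ℝ) : ℂ)) *
      Complex.exp (Complex.I * (φ (p.1, w₀.2) : ℂ)) *
      Complex.exp (Complex.I * (φ (w₀.1, p.2) : ℂ)) *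
      Complex.exp (Complex.I * (mixedDiff φ w₀ (p.1 - w₀.1, p.2 - w₀.2) : ℂ)) =
      Complex.exp (Complex.I * (φ p : ℂ)) := by
    rw [← Complex.exp_add, ← Complex.exp_add, ← Complex.exp_add]
    congr 1
    have e2 : w₀ + projX d (p.1 - w₀.1, p.2 - w₀.2) = (p.1, w₀.2) := by
      ext1 <;> simp [projX]
    have e3 : w₀ + projXi d (p.1 - w₀.1, p.2 - w₀.2) = (w₀.1, p.2) := by
      ext1 <;> simp [projXi]
    rw [mixedDiff, e1, e2, e3]
    push_cast
    ring
  have h4 := hc (p.1 - w₀.1) (p.2 - w₀.2)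
  rw [e1] at h4
  simp_rw [h1]
  rw [integral_const_mul, ← h4, ← h2]
  push_cast
  ring

/-- For fixed frequency `w` the expanded kernel is a product of a function of `x` and a function of
`ξ`; Fubini in `w` turns the cell integral into a superposition of products of packet coefficients.
-/
theorem enorm_integral_localized_le
    {φ : EuclideanSpace ℝ (Fin d) × EuclideanSpace ℝ (Fin d) → ℝ} (hφ : Continuous φ)
    {a : EuclideanSpace ℝ (Fin d) × EuclideanSpace ℝ (Fin d) → ℂ}
    {γ : EuclideanSpace ℝ (Fin d) → ℝ} (hγ : Continuous γ) (hγs : HasCompactSupport γ)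
    {w₀ : EuclideanSpace ℝ (Fin d) × EuclideanSpace ℝ (Fin d)}
    {c : WithLp 2 (EuclideanSpace ℝ (Fin d) × EuclideanSpace ℝ (Fin d)) → ℂ}
    (hcint : Integrable c)
    (hc : ∀ x ξ, γ x * γ ξ * a (w₀ + (x, ξ)) *
          Complex.exp (Complex.I * (mixedDiff φ w₀ (x, ξ) : ℂ)) =
        ∫ w, c w * (Complex.exp (Complex.I * ((2 * Real.pi * inner ℝ w.fst x : ℝ) : ℂ)) *
          Complex.exp (Complex.I * ((2 * Real.pi * inner ℝ w.snd ξ : ℝ) : ℂ))))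
    {g h : EuclideanSpace ℝ (Fin d) → ℂ} (hg : Integrable g) (hh : Integrable h) :
    ‖∫ p : EuclideanSpace ℝ (Fin d) × EuclideanSpace ℝ (Fin d),
      Complex.exp (Complex.I * (φ p : ℂ)) * a p * (h p.1 * g p.2) *
        (((γ (p.1 - w₀.1) ^ 3 : ℝ) : ℂ) * ((γ (p.2 - w₀.2) ^ 3 : ℝ) : ℂ))‖ₑ ≤
      ∫⁻ w, ‖c w‖ₑ * (‖packet (fun q => φ q.swap) γ h w.fst w₀.2 w₀.1‖ₑ *
        ‖packet φ γ g w.snd w₀.1 w₀.2‖ₑ) := by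
  obtain ⟨B, hB⟩ := hγs.exists_bound_of_continuous hγ
  have hφs : Continuous fun q : EuclideanSpace ℝ (Fin d) × EuclideanSpace ℝ (Fin d) => φ q.swap :=
    hφ.comp continuous_swap
  have hint : Integrable (Function.uncurry
      fun (p : EuclideanSpace ℝ (Fin d) × EuclideanSpace ℝ (Fin d))
        (w : WithLp 2 (EuclideanSpace ℝ (Fin d) × EuclideanSpace ℝ (Fin d))) =>
      (packetKernel (fun q => φ q.swap) γ w.fst w₀.2 w₀.1 p.1 *
        packetKernel φ γ w.snd w₀.1 w₀.2 p.2) * ((h p.1 * g p.2) * c w))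
      (volume.prod volume) := by
    refine ((hh.mul_prod hg).mul_prod hcint).bdd_mul (c := (B * B) * (B * B))
      (f := fun t : (EuclideanSpace ℝ (Fin d) × EuclideanSpace ℝ (Fin d)) ×
        WithLp 2 (EuclideanSpace ℝ (Fin d) × EuclideanSpace ℝ (Fin d)) =>
        packetKernel (fun q => φ q.swap) γ t.2.fst w₀.2 w₀.1 t.1.1 *
          packetKernel φ γ t.2.snd w₀.1 w₀.2 t.1.2) ?_ (Filter.Eventually.of_forall fun t => ?_)
    · exact ((continuous_packetKernel hφs hγ (by fun_prop) continuous_const continuous_const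
        (by fun_prop)).mul (continuous_packetKernel hφ hγ (by fun_prop) continuous_const
        continuous_const (by fun_prop))).aestronglyMeasurable
    · rw [norm_mul]
      exact mul_le_mul (norm_packetKernel_le hB _ _ _ _) (norm_packetKernel_le hB _ _ _ _)
        (norm_nonneg _) (mul_self_nonneg B)
  have hJ : ∫ p : EuclideanSpace ℝ (Fin d) × EuclideanSpace ℝ (Fin d),
      Complex.exp (Complex.I * (φ p : ℂ)) * a p * (h p.1 * g p.2) *
        (((γ (p.1 - w₀.1) ^ 3 : ℝ) : ℂ) * ((γ (p.2 - w₀.2) ^ 3 : ℝ) : ℂ)) =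
      Complex.exp (Complex.I * ((-φ w₀ : ℝ) : ℂ)) *
        ∫ w, c w * (packet (fun q => φ q.swap) γ h w.fst w₀.2 w₀.1 *
          packet φ γ g w.snd w₀.1 w₀.2) := by
    simp_rw [localized_kernel_eq hc]
    rw [integral_const_mul, integral_integral_swap hint]
    congr 1
    refine integral_congr_ae (Filter.Eventually.of_forall fun w => ?_)
    have h1 : ∀ p : EuclideanSpace ℝ (Fin d) × EuclideanSpace ℝ (Fin d),
        (packetKernel (fun q => φ q.swap) γ w.fst w₀.2 w₀.1 p.1 *
          packetKernel φ γ w.snd w₀.1 w₀.2 p.2) * ((h p.1 * g p.2) * c w) =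
        c w * ((packetKernel (fun q => φ q.swap) γ w.fst w₀.2 w₀.1 p.1 * h p.1) *
          (packetKernel φ γ w.snd w₀.1 w₀.2 p.2 * g p.2)) := fun p => by ring
    beta_reduce
    simp_rw [h1]
    rw [integral_const_mul, Measure.volume_eq_prod]
    congr 1
    exact integral_prod_mul (fun x => packetKernel (fun q => φ q.swap) γ w.fst w₀.2 w₀.1 x * h x)
      fun ξ => packetKernel φ γ w.snd w₀.1 w₀.2 ξ * g ξ
  rw [hJ, enorm_mul, ← ofReal_norm, norm_cexp_I, ENNReal.ofReal_one, one_mul]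
  refine (enorm_integral_le_lintegral_enorm _).trans (le_of_eq (lintegral_congr fun w => ?_))
  rw [enorm_mul, enorm_mul]

end Packet

/-! ### Integration over phase space and the bilinear estimate -/

section Localization

variable {d : ℕ}

/-- A smooth even cutoff function. -/
theorem exists_cutoff (d : ℕ) : ∃ γ : EuclideanSpace ℝ (Fin d) → ℝ, ContDiff ℝ ∞ γ ∧
    HasCompactSupport γ ∧ (∀ x, γ (-x) = γ x) ∧ ∫ x, γ x ^ 3 ≠ 0 := by
  obtain ⟨γ, hγ, hγs, hγn, hγp, hγ0⟩ : ∃ γ : EuclideanSpace ℝ (Fin d) → ℝ, ContDiff ℝ ∞ γ ∧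
      HasCompactSupport γ ∧ (∀ x, γ (-x) = γ x) ∧ (∀ x, 0 ≤ γ x) ∧ γ 0 = 1 := by
    let β : ContDiffBump (0 : EuclideanSpace ℝ (Fin d)) := ⟨1, 2, one_pos, one_lt_two⟩
    exact ⟨β, β.contDiff, β.hasCompactSupport, β.neg, fun _ => β.nonneg,
      β.one_of_mem_closedBall (Metric.mem_closedBall_self zero_le_one)⟩
  have hs : HasCompactSupport fun x => γ x ^ 3 :=
    hγs.comp_left (g := fun t : ℝ => t ^ 3) (by simp)
  have hp : 0 < ∫ x, γ x ^ 3 :=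
    Continuous.integral_pos_of_hasCompactSupport_nonneg_nonzero (f := fun x => γ x ^ 3) (x := 0)
      (hγ.continuous.pow 3) hs (fun x => pow_nonneg (hγp x) 3) (by simp [hγ0])
  exact ⟨γ, hγ, hγs, hγn, hp.ne'⟩

/-- The inner integral is the convolution of `k` with `γ³ ⊗ γ³`, and the integral of a convolution
is the product of the integrals. Evenness of `γ` fixes the sign of the argument. -/
theorem integral_integral_localize
    {k : EuclideanSpace ℝ (Fin d) × EuclideanSpace ℝ (Fin d) → ℂ}
    (hk : Integrable k) {γ : EuclideanSpace ℝ (Fin d) → ℝ} (hγ : Continuous γ)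
    (hγs : HasCompactSupport γ) (hγn : ∀ x, γ (-x) = γ x) :
    ∫ w₀ : EuclideanSpace ℝ (Fin d) × EuclideanSpace ℝ (Fin d),
      ∫ p, k p * (((γ (p.1 - w₀.1) ^ 3 : ℝ) : ℂ) * ((γ (p.2 - w₀.2) ^ 3 : ℝ) : ℂ)) =
    (∫ p, k p) * (((∫ x, γ x ^ 3) ^ 2 : ℝ) : ℂ) := by
  have hγ3 : Integrable fun x => ((γ x ^ 3 : ℝ) : ℂ) := by
    refine Continuous.integrable_of_hasCompactSupport
      (Complex.continuous_ofReal.comp (hγ.pow 3)) ?_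
    exact hγs.comp_left (g := fun t : ℝ => ((t ^ 3 : ℝ) : ℂ)) (by simp)
  have : (volume : Measure (EuclideanSpace ℝ (Fin d) ×
      EuclideanSpace ℝ (Fin d))).IsAddRightInvariant := by
    rw [Measure.volume_eq_prod]
    infer_instance
  have h1 := integral_convolution (μ := volume) (ν := volume) (ContinuousLinearMap.mul ℝ ℂ) hk
    (hγ3.mul_prod hγ3)
  have h2 : ∫ p : EuclideanSpace ℝ (Fin d) × EuclideanSpace ℝ (Fin d),
      ((γ p.1 ^ 3 : ℝ) : ℂ) * ((γ p.2 ^ 3 : ℝ) : ℂ) = (((∫ x, γ x ^ 3) ^ 2 : ℝ) : ℂ) := by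
    rw [Measure.volume_eq_prod]
    refine (integral_prod_mul (fun x => ((γ x ^ 3 : ℝ) : ℂ))
      (fun x => ((γ x ^ 3 : ℝ) : ℂ))).trans ?_
    rw [integral_complex_ofReal, sq, Complex.ofReal_mul]
  rw [ContinuousLinearMap.mul_apply', h2] at h1
  refine Eq.trans (integral_congr_ae (Filter.Eventually.of_forall fun w₀ => ?_)) h1
  refine integral_congr_ae (Filter.Eventually.of_forall fun p => ?_)
  simp only [ContinuousLinearMap.mul_apply', Prod.fst_sub, Prod.snd_sub]
  rw [← hγn, ← hγn (p.2 - w₀.2), neg_sub, neg_sub]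

theorem enorm_integral_le_of_localized
    {k : EuclideanSpace ℝ (Fin d) × EuclideanSpace ℝ (Fin d) → ℂ}
    (hk : Integrable k) {γ : EuclideanSpace ℝ (Fin d) → ℝ} (hγ : Continuous γ)
    (hγs : HasCompactSupport γ) (hγn : ∀ x, γ (-x) = γ x) (hγ0 : ∫ x, γ x ^ 3 ≠ 0) {X : ℝ≥0∞}
    (hX : ∫⁻ w₀ : EuclideanSpace ℝ (Fin d) × EuclideanSpace ℝ (Fin d),
      ‖∫ p, k p * (((γ (p.1 - w₀.1) ^ 3 : ℝ) : ℂ) * ((γ (p.2 - w₀.2) ^ 3 : ℝ) : ℂ))‖ₑ ≤ X) :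
    ‖∫ p, k p‖ₑ ≤ X / ‖(∫ x, γ x ^ 3) ^ 2‖ₑ := by
  have h0 : ‖(∫ x, γ x ^ 3) ^ 2‖ₑ ≠ 0 := by simpa using hγ0
  have h1 : ‖(((∫ x, γ x ^ 3) ^ 2 : ℝ) : ℂ)‖ₑ = ‖(∫ x, γ x ^ 3) ^ 2‖ₑ := by
    rw [← ofReal_norm, ← ofReal_norm, Complex.norm_real]
  rw [ENNReal.le_div_iff_mul_le (Or.inl h0) (Or.inl enorm_ne_top), ← h1, ← enorm_mul,
    ← integral_integral_localize hk hγ hγs hγn]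
  exact (enorm_integral_le_lintegral_enorm _).trans hX

/-- After Tonelli, Cauchy-Schwarz in `w₀ = (z,ζ)` is applied for each frequency separately. The
bounds `X` and `Y` do not depend on the frequency, so only the integral of `|M|` remains. -/
theorem lintegral_lintegral_packets_le
    {φ : EuclideanSpace ℝ (Fin d) × EuclideanSpace ℝ (Fin d) → ℝ} (hφ : Continuous φ)
    {γ : EuclideanSpace ℝ (Fin d) → ℝ} (hγ : Continuous γ) (hγs : HasCompactSupport γ)
    {M : WithLp 2 (EuclideanSpace ℝ (Fin d) × EuclideanSpace ℝ (Fin d)) → ℝ} (hM : Integrable M)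
    {g h : EuclideanSpace ℝ (Fin d) → ℂ} (hg : Integrable g) (hh : Integrable h) {X Y : ℝ≥0∞}
    (hG : ∀ q, ∫⁻ ζ, ∫⁻ z, ‖packet φ γ g q z ζ‖ₑ ^ 2 ≤ X)
    (hH : ∀ q, ∫⁻ z, ∫⁻ ζ, ‖packet (fun q => φ q.swap) γ h q ζ z‖ₑ ^ 2 ≤ Y) :
    ∫⁻ w₀ : EuclideanSpace ℝ (Fin d) × EuclideanSpace ℝ (Fin d),
      ∫⁻ w, ‖M w‖ₑ * (‖packet (fun q => φ q.swap) γ h w.fst w₀.2 w₀.1‖ₑ *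
        ‖packet φ γ g w.snd w₀.1 w₀.2‖ₑ) ≤ (∫⁻ w, ‖M w‖ₑ) * (Y * X) ^ (1 / 2 : ℝ) := by
  have hφs : Continuous fun q : EuclideanSpace ℝ (Fin d) × EuclideanSpace ℝ (Fin d) => φ q.swap :=
    hφ.comp continuous_swap
  rw [lintegral_lintegral_swap]
  · rw [← lintegral_mul_const'' _ hM.1.enorm]
    refine lintegral_mono fun w => ?_
    have m1 : Measurable fun w₀ : EuclideanSpace ℝ (Fin d) × EuclideanSpace ℝ (Fin d) =>
        ‖packet (fun q => φ q.swap) γ h w.fst w₀.2 w₀.1‖ₑ :=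
      (continuous_packet hφs hγ hγs hh continuous_const continuous_snd
        continuous_fst).enorm.measurable
    have m2 : Measurable fun w₀ : EuclideanSpace ℝ (Fin d) × EuclideanSpace ℝ (Fin d) =>
        ‖packet φ γ g w.snd w₀.1 w₀.2‖ₑ :=
      (continuous_packet hφ hγ hγs hg continuous_const continuous_fst
        continuous_snd).enorm.measurable
    have m12 : Measurable fun w₀ : EuclideanSpace ℝ (Fin d) × EuclideanSpace ℝ (Fin d) =>
        ‖packet (fun q => φ q.swap) γ h w.fst w₀.2 w₀.1‖ₑ * ‖packet φ γ g w.snd w₀.1 w₀.2‖ₑ :=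
      m1.mul m2
    beta_reduce
    rw [lintegral_const_mul _ m12]
    gcongr
    rw [one_div, ENNReal.le_rpow_inv_iff two_pos, ENNReal.rpow_two]
    refine (lintegral_mul_sq_le m1.aemeasurable m2.aemeasurable).trans (mul_le_mul' ?_ ?_)
    · rw [Measure.volume_eq_prod, lintegral_prod _ (m1.pow_const 2).aemeasurable]
      exact hH w.fst
    · rw [Measure.volume_eq_prod, lintegral_prod_symm _ (m2.pow_const 2).aemeasurable]
      exact hG w.snd
  · have c1 : Continuous fun t : (EuclideanSpace ℝ (Fin d) × EuclideanSpace ℝ (Fin d)) ×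
        WithLp 2 (EuclideanSpace ℝ (Fin d) × EuclideanSpace ℝ (Fin d)) =>
        packet (fun q => φ q.swap) γ h t.2.fst t.1.2 t.1.1 :=
      continuous_packet hφs hγ hγs hh (by fun_prop) (by fun_prop) (by fun_prop)
    have c2 : Continuous fun t : (EuclideanSpace ℝ (Fin d) × EuclideanSpace ℝ (Fin d)) ×
        WithLp 2 (EuclideanSpace ℝ (Fin d) × EuclideanSpace ℝ (Fin d)) =>
        packet φ γ g t.2.snd t.1.1 t.1.2 :=
      continuous_packet hφ hγ hγs hg (by fun_prop) (by fun_prop) (by fun_prop)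
    exact hM.1.enorm.comp_snd.mul
      (c1.enorm.measurable.aemeasurable.mul c2.enorm.measurable.aemeasurable)

theorem exists_enorm_bilinear_sq_le
    {φ : EuclideanSpace ℝ (Fin d) × EuclideanSpace ℝ (Fin d) → ℝ} (hφ : ContDiff ℝ ∞ φ)
    (hb : ∀ n i j, BddDerivs (prodBasis d) Set.univ n
      fun (_ : Unit) => partialX i (partialXi j φ))
    {M₁ M₂ : ℝ} (hM₁ : ∀ z z' ξ, ‖z - z'‖ ≤ M₁ * ‖gradXi φ (z, ξ) - gradXi φ (z', ξ)‖)
    (hM₂ : ∀ ζ ζ' x, ‖ζ - ζ'‖ ≤ M₂ * ‖gradX φ (x, ζ) - gradX φ (x, ζ')‖)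
    {a : EuclideanSpace ℝ (Fin d) × EuclideanSpace ℝ (Fin d) → ℂ} (ha : ContDiff ℝ ∞ a)
    (hab : ∀ n, BddDerivs (prodBasis d) Set.univ n fun (_ : Unit) => a) :
    ∃ A : ℝ≥0∞, A ≠ ⊤ ∧ ∀ g h : EuclideanSpace ℝ (Fin d) → ℂ, Integrable g → Integrable h →
      ‖∫ p : EuclideanSpace ℝ (Fin d) × EuclideanSpace ℝ (Fin d),
        Complex.exp (Complex.I * (φ p : ℂ)) * a p * (h p.1 * g p.2)‖ₑ ^ 2 ≤
        A * (∫⁻ ξ, ‖g ξ‖ₑ ^ 2) * ∫⁻ x, ‖h x‖ₑ ^ 2 := by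
  obtain ⟨γ, hγ, hγs, hγn, hγ0⟩ := exists_cutoff d
  obtain ⟨D, hD⟩ := (hab 0).bdd
  obtain ⟨A₁, hA₁, hG⟩ := exists_lintegral_packet_sq_le hφ hb hM₁ hγ hγs
  obtain ⟨A₂, hA₂, hH⟩ := exists_lintegral_packet_sq_le (φ := fun q => φ q.swap)
    (contDiff_comp_swap hφ) (fun n i j => bddDerivs_mixed_comp_swap hφ i j (hb n j i))
    (M := M₂) (fun z z' ξ => by
      simpa only [gradXi_comp_swap hφ, Prod.swap_prod_mk] using hM₂ z z' ξ) hγ hγs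
  obtain ⟨M, hM, hexp⟩ := exists_packet_expansion hφ hb ha hab hγ hγs
  have h0 : ‖(∫ x, γ x ^ 3) ^ 2‖ₑ ≠ 0 := by simpa using hγ0
  refine ⟨((∫⁻ w, ‖M w‖ₑ) / ‖(∫ x, γ x ^ 3) ^ 2‖ₑ) ^ 2 * (A₁ * A₂), ?_, fun g h hg hh => ?_⟩
  · exact ENNReal.mul_ne_top (ENNReal.pow_ne_top (ENNReal.div_ne_top hM.2.ne h0))
      (ENNReal.mul_ne_top hA₁ hA₂)
  have hk : Integrable fun p : EuclideanSpace ℝ (Fin d) × EuclideanSpace ℝ (Fin d) =>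
      Complex.exp (Complex.I * (φ p : ℂ)) * a p * (h p.1 * g p.2) := by
    refine (hh.mul_prod hg).bdd_mul (c := D)
      ((contDiff_cexp_I hφ).mul ha).continuous.aestronglyMeasurable
      (Filter.Eventually.of_forall fun p => ?_)
    rw [norm_mul, norm_cexp_I, one_mul]
    exact hD () p (Set.mem_univ p)
  -- The coefficients `c` are chosen cell by cell, with no measurability in `w₀`. They are replaced
  -- by the common majorant `M` before the order of integration is exchanged.
  have hfin := enorm_integral_le_of_localized hk hγ.continuous hγs hγn hγ0
    ((lintegral_mono fun w₀ => by
      obtain ⟨c, hc, hcM, hce⟩ := hexp w₀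
      refine (enorm_integral_localized_le hφ.continuous hγ.continuous hγs
        (hM.mono' hc.aestronglyMeasurable (Filter.Eventually.of_forall hcM)) hce hg hh).trans
        (lintegral_mono fun w => mul_le_mul_left ?_ _)
      rw [← ofReal_norm, ← ofReal_norm]
      exact ENNReal.ofReal_le_ofReal ((hcM w).trans (le_abs_self _))).trans
      (lintegral_lintegral_packets_le hφ.continuous hγ.continuous hγs hM hg hh (hG g hg)
        (hH h hh)))
  have hs : ∀ X : ℝ≥0∞, (X ^ (1 / 2 : ℝ)) ^ 2 = X := fun X => by
    rw [← ENNReal.rpow_natCast, ← ENNReal.rpow_mul]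
    norm_num
  refine (pow_le_pow_left' hfin 2).trans (le_of_eq ?_)
  rw [ENNReal.mul_div_right_comm, mul_pow, hs]
  ring

end Localization

/-! ### The Fourier integral operator and its extension to `L²` -/

section FourierIntegralOperator

variable {d : ℕ}

theorem fourier_eq (f : 𝓢(EuclideanSpace ℝ (Fin d), ℂ)) (ξ : EuclideanSpace ℝ (Fin d)) :
    fourier (fun y => f y) ξ = (((2 * Real.pi) ^ (-(d : ℝ) / 2) : ℝ) : ℂ) *
      FourierTransform.fourier f ((2 * Real.pi)⁻¹ • ξ) := by
  rw [fourier, SchwartzMap.fourier_coe, Real.fourier_eq']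
  congr 1
  refine integral_congr_ae (Filter.Eventually.of_forall fun x => ?_)
  beta_reduce
  rw [smul_eq_mul, mul_comm, inner_smul_right]
  congr 2
  push_cast
  have : (Real.pi : ℂ) ≠ 0 := Complex.ofReal_ne_zero.mpr Real.pi_ne_zero
  field_simp

theorem integrable_fourier (f : 𝓢(EuclideanSpace ℝ (Fin d), ℂ)) :
    Integrable (fourier fun y => f y) := by
  have h : Integrable fun ξ => FourierTransform.fourier f ((2 * Real.pi)⁻¹ • ξ) :=
    (SchwartzMap.integrable (FourierTransform.fourier f)).comp_smul
      (inv_ne_zero Real.two_pi_pos.ne')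
  exact (h.const_mul _).congr (Filter.Eventually.of_forall fun ξ => (fourier_eq f ξ).symm)

theorem eLpNorm_two_sq {α F : Type*} [MeasurableSpace α] [NormedAddCommGroup F] (μ : Measure α)
    (f : α → F) : eLpNorm f 2 μ ^ 2 = ∫⁻ x, ‖f x‖ₑ ^ 2 ∂μ := by
  have h := eLpNorm_nnreal_pow_eq_lintegral (f := f) (μ := μ) (p := 2) two_ne_zero
  simpa [ENNReal.rpow_two] using h

/-- Plancherel after rescaling the frequency by `2π`. With this normalization the constant equals 1,
but only its finiteness is used. -/
theorem exists_lintegral_fourier_sq_le (d : ℕ) : ∃ B : ℝ≥0∞, B ≠ ⊤ ∧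
    ∀ f : 𝓢(EuclideanSpace ℝ (Fin d), ℂ),
      ∫⁻ ξ, ‖fourier (fun y => f y) ξ‖ₑ ^ 2 ≤ B * ∫⁻ x, ‖f x‖ₑ ^ 2 := by
  obtain ⟨c, hc⟩ : ∃ c : ℂ, c = (((2 * Real.pi) ^ (-(d : ℝ) / 2) : ℝ) : ℂ) := ⟨_, rfl⟩
  obtain ⟨k, hk, hk0⟩ : ∃ k : ℝ, k = (2 * Real.pi)⁻¹ ∧ k ≠ 0 :=
    ⟨_, rfl, inv_ne_zero Real.two_pi_pos.ne'⟩
  refine ⟨‖c‖ₑ ^ 2 * ENNReal.ofReal |(k ^ Module.finrank ℝ (EuclideanSpace ℝ (Fin d)))⁻¹|,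
    ENNReal.mul_ne_top (ENNReal.pow_ne_top enorm_ne_top) ENNReal.ofReal_ne_top, fun f => ?_⟩
  have hm : Measurable fun ξ => ‖FourierTransform.fourier f ξ‖ₑ ^ 2 :=
    (SchwartzMap.continuous _).enorm.measurable.pow_const 2
  have h1 : ∫⁻ ξ, ‖FourierTransform.fourier f (k • ξ)‖ₑ ^ 2 =
      ENNReal.ofReal |(k ^ Module.finrank ℝ (EuclideanSpace ℝ (Fin d)))⁻¹| *
        ∫⁻ ξ, ‖FourierTransform.fourier f ξ‖ₑ ^ 2 := by
    rw [← lintegral_map (f := fun ξ => ‖FourierTransform.fourier f ξ‖ₑ ^ 2) hm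
      (measurable_const_smul k), Measure.map_addHaar_smul volume hk0, lintegral_smul_measure,
      smul_eq_mul]
  have h2 : ∫⁻ ξ, ‖FourierTransform.fourier f ξ‖ₑ ^ 2 = ∫⁻ x, ‖f x‖ₑ ^ 2 := by
    have h := SchwartzMap.norm_fourier_toL2_eq f
    rw [SchwartzMap.norm_toLp, SchwartzMap.norm_toLp] at h
    have h' := (ENNReal.toReal_eq_toReal_iff'
      ((FourierTransform.fourier f).memLp 2 volume).eLpNorm_ne_top
      (f.memLp 2 volume).eLpNorm_ne_top).1 h
    rw [← eLpNorm_two_sq, ← eLpNorm_two_sq, h']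
  simp_rw [fourier_eq, ← hc, ← hk, enorm_mul, mul_pow]
  rw [lintegral_const_mul' _ _ (ENNReal.pow_ne_top enorm_ne_top), h1, h2, mul_assoc]

theorem integrable_Op_integrand
    {φ : EuclideanSpace ℝ (Fin d) × EuclideanSpace ℝ (Fin d) → ℝ} (hφ : Continuous φ)
    {a : EuclideanSpace ℝ (Fin d) × EuclideanSpace ℝ (Fin d) → ℂ} (ha : Continuous a)
    {D : ℝ} (hD : ∀ p, ‖a p‖ ≤ D) (f : 𝓢(EuclideanSpace ℝ (Fin d), ℂ))
    (x : EuclideanSpace ℝ (Fin d)) :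
    Integrable fun ξ => Complex.exp (Complex.I * ((φ (x, ξ) : ℝ) : ℂ)) * a (x, ξ) *
      fourier (fun y => f y) ξ := by
  refine (integrable_fourier f).bdd_mul (c := D)
    (Continuous.aestronglyMeasurable (by fun_prop)) (Filter.Eventually.of_forall fun ξ => ?_)
  rw [norm_mul, norm_cexp_I, one_mul]
  exact hD _

theorem continuous_Op
    {φ : EuclideanSpace ℝ (Fin d) × EuclideanSpace ℝ (Fin d) → ℝ} (hφ : Continuous φ)
    {a : EuclideanSpace ℝ (Fin d) × EuclideanSpace ℝ (Fin d) → ℂ} (ha : Continuous a)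
    {D : ℝ} (hD : ∀ p, ‖a p‖ ≤ D) (f : 𝓢(EuclideanSpace ℝ (Fin d), ℂ)) :
    Continuous (Op φ a f) := by
  refine continuous_const.mul (continuous_of_dominated
    (bound := fun ξ => D * ‖fourier (fun y => f y) ξ‖)
    (fun x => (integrable_Op_integrand hφ ha hD f x).aestronglyMeasurable)
    (fun x => Filter.Eventually.of_forall fun ξ => ?_)
    ((integrable_fourier f).norm.const_mul D)
    (Filter.Eventually.of_forall fun ξ => by fun_prop))
  rw [norm_mul, norm_mul, norm_cexp_I, one_mul]
  exact mul_le_mul_of_nonneg_right (hD _) (norm_nonneg _)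

theorem integral_Op_mul
    {φ : EuclideanSpace ℝ (Fin d) × EuclideanSpace ℝ (Fin d) → ℝ} (hφ : Continuous φ)
    {a : EuclideanSpace ℝ (Fin d) × EuclideanSpace ℝ (Fin d) → ℂ} (ha : Continuous a)
    {D : ℝ} (hD : ∀ p, ‖a p‖ ≤ D) (f : 𝓢(EuclideanSpace ℝ (Fin d), ℂ))
    {h : EuclideanSpace ℝ (Fin d) → ℂ} (hh : Integrable h) :
    ∫ x, Op φ a f x * h x = (((2 * Real.pi) ^ (-(d : ℝ) / 2) : ℝ) : ℂ) *
      ∫ p : EuclideanSpace ℝ (Fin d) × EuclideanSpace ℝ (Fin d),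
        Complex.exp (Complex.I * (φ p : ℂ)) * a p * (h p.1 * fourier (fun y => f y) p.2) := by
  have hk : Integrable fun p : EuclideanSpace ℝ (Fin d) × EuclideanSpace ℝ (Fin d) =>
      Complex.exp (Complex.I * (φ p : ℂ)) * a p * (h p.1 * fourier (fun y => f y) p.2) := by
    refine (hh.mul_prod (integrable_fourier f)).bdd_mul (c := D)
      (Continuous.aestronglyMeasurable (by fun_prop)) (Filter.Eventually.of_forall fun p => ?_)
    rw [norm_mul, norm_cexp_I, one_mul]
    exact hD p
  rw [Measure.volume_eq_prod] at hk ⊢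
  rw [integral_prod _ hk, ← integral_const_mul]
  refine integral_congr_ae (Filter.Eventually.of_forall fun x => ?_)
  simp only [Op]
  rw [mul_assoc, ← integral_mul_const]
  congr 1
  refine integral_congr_ae (Filter.Eventually.of_forall fun ξ => ?_)
  ring

/-- The bilinear estimate is applied to the Fourier transform of `f` and an arbitrary integrable
`h`. Duality turns it into a bound by the `L²` norm of the transform, and Plancherel returns to `f`.
-/
theorem exists_lintegral_Op_sq_le {r ρ : ℝ} (hr : 0 ≤ r) (hρ : 0 ≤ ρ)
    {φ : EuclideanSpace ℝ (Fin d) × EuclideanSpace ℝ (Fin d) → ℝ} (hφ : IsRegularPhase φ)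
    {a : EuclideanSpace ℝ (Fin d) × EuclideanSpace ℝ (Fin d) → ℂ} (ha : IsSG 0 0 r ρ a) :
    ∃ A : ℝ≥0∞, A ≠ ⊤ ∧ ∀ f : 𝓢(EuclideanSpace ℝ (Fin d), ℂ),
      ∫⁻ x, ‖Op φ a f x‖ₑ ^ 2 ≤ A * ∫⁻ x, ‖f x‖ₑ ^ 2 := by
  obtain ⟨M₁, hM₁⟩ := hφ.exists_gradXi_lower
  obtain ⟨M₂, hM₂⟩ := hφ.exists_gradX_lower
  obtain ⟨A, hA, hAb⟩ := exists_enorm_bilinear_sq_le hφ.isSG.1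
    (fun n i j => hφ.isSG.bddDerivs_mixed n i j) hM₁ hM₂ ha.1 (fun n => ha.bddDerivs hr hρ n)
  obtain ⟨B, hB, hBf⟩ := exists_lintegral_fourier_sq_le d
  obtain ⟨D, hD⟩ := (ha.bddDerivs hr hρ 0).bdd
  have hD' : ∀ p, ‖a p‖ ≤ D := fun p => hD () p (Set.mem_univ p)
  obtain ⟨c, hc⟩ : ∃ c : ℂ, c = (((2 * Real.pi) ^ (-(d : ℝ) / 2) : ℝ) : ℂ) := ⟨_, rfl⟩
  refine ⟨‖c‖ₑ ^ 2 * (A * B), ENNReal.mul_ne_top (ENNReal.pow_ne_top enorm_ne_top)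
    (ENNReal.mul_ne_top hA hB), fun f => ?_⟩
  refine lintegral_enorm_sq_le_of_dual
    (continuous_Op hφ.isSG.1.continuous ha.1.continuous hD' f) fun h hh => ?_
  rw [integral_Op_mul hφ.isSG.1.continuous ha.1.continuous hD' f hh, ← hc, enorm_mul, mul_pow,
    mul_assoc, mul_assoc]
  gcongr
  refine (hAb _ h (integrable_fourier f) hh).trans ?_
  rw [← mul_assoc, mul_assoc A B]
  gcongr
  exact hBf f

theorem Op_add
    {φ : EuclideanSpace ℝ (Fin d) × EuclideanSpace ℝ (Fin d) → ℝ} (hφ : Continuous φ)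
    {a : EuclideanSpace ℝ (Fin d) × EuclideanSpace ℝ (Fin d) → ℂ} (ha : Continuous a)
    {D : ℝ} (hD : ∀ p, ‖a p‖ ≤ D) (f g : 𝓢(EuclideanSpace ℝ (Fin d), ℂ)) :
    Op φ a (f + g) = Op φ a f + Op φ a g := by
  funext x
  simp only [Op, Pi.add_apply]
  rw [← mul_add, ← integral_add (integrable_Op_integrand hφ ha hD f x)
    (integrable_Op_integrand hφ ha hD g x)]
  congr 1
  refine integral_congr_ae (Filter.Eventually.of_forall fun ξ => ?_)
  beta_reduce
  rw [fourier_eq, fourier_eq, fourier_eq, FourierTransform.fourier_add, add_apply]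
  ring

theorem Op_smul
    (φ : EuclideanSpace ℝ (Fin d) × EuclideanSpace ℝ (Fin d) → ℝ)
    (a : EuclideanSpace ℝ (Fin d) × EuclideanSpace ℝ (Fin d) → ℂ)
    (c : ℂ) (f : 𝓢(EuclideanSpace ℝ (Fin d), ℂ)) :
    Op φ a (c • f) = c • Op φ a f := by
  funext x
  simp only [Op, Pi.smul_apply, smul_eq_mul]
  rw [mul_left_comm, ← integral_const_mul c]
  congr 1
  refine integral_congr_ae (Filter.Eventually.of_forall fun ξ => ?_)
  beta_reduce
  rw [fourier_eq, fourier_eq, FourierTransform.fourier_smul, smul_apply, smul_eq_mul]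
  ring

theorem exists_eLpNorm_Op_le {r ρ : ℝ} (hr : 0 ≤ r) (hρ : 0 ≤ ρ)
    {φ : EuclideanSpace ℝ (Fin d) × EuclideanSpace ℝ (Fin d) → ℝ} (hφ : IsRegularPhase φ)
    {a : EuclideanSpace ℝ (Fin d) × EuclideanSpace ℝ (Fin d) → ℂ} (ha : IsSG 0 0 r ρ a) :
    ∃ A : ℝ≥0∞, A ≠ ⊤ ∧ ∀ f : 𝓢(EuclideanSpace ℝ (Fin d), ℂ),
      eLpNorm (Op φ a f) 2 volume ≤ A * eLpNorm f 2 volume := by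
  obtain ⟨A, hA, hAf⟩ := exists_lintegral_Op_sq_le hr hρ hφ ha
  refine ⟨A ^ (1 / 2 : ℝ), ENNReal.rpow_ne_top_of_nonneg (by norm_num) hA, fun f => ?_⟩
  have hs : (A ^ (1 / 2 : ℝ)) ^ 2 = A := by
    rw [← ENNReal.rpow_natCast, ← ENNReal.rpow_mul]
    norm_num
  rw [← ENNReal.pow_le_pow_left_iff two_ne_zero, mul_pow, hs, eLpNorm_two_sq, eLpNorm_two_sq]
  exact hAf f

/-- A linear map from Schwartz functions to `L²` that is bounded in the `L²` norm has a unique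
bounded extension to `L²`. -/
theorem existsUnique_extension
    (S : 𝓢(EuclideanSpace ℝ (Fin d), ℂ) →ₗ[ℂ] Lp ℂ 2 (volume : Measure (EuclideanSpace ℝ (Fin d))))
    {C : ℝ} (hS : ∀ f, ‖S f‖ ≤ C * ‖f.toLp 2 volume‖) :
    ∃! T : Lp ℂ 2 (volume : Measure (EuclideanSpace ℝ (Fin d))) →L[ℂ]
        Lp ℂ 2 (volume : Measure (EuclideanSpace ℝ (Fin d))),
      ∀ f : 𝓢(EuclideanSpace ℝ (Fin d), ℂ), T (f.toLp 2 volume) = S f := by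
  obtain ⟨e, he⟩ : ∃ e : 𝓢(EuclideanSpace ℝ (Fin d), ℂ) →ₗ[ℂ]
      Lp ℂ 2 (volume : Measure (EuclideanSpace ℝ (Fin d))), ∀ f, e f = f.toLp 2 volume :=
    ⟨(SchwartzMap.toLpCLM ℂ ℂ 2 volume).toLinearMap, fun _ => rfl⟩
  have hde : DenseRange e := by
    have h : DenseRange fun f : 𝓢(EuclideanSpace ℝ (Fin d), ℂ) => f.toLp 2 volume :=
      SchwartzMap.denseRange_toLpCLM ENNReal.ofNat_ne_top
    rwa [← funext he] at h
  simp_rw [← he] at hS ⊢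
  refine ⟨S.extendOfNorm e, LinearMap.extendOfNorm_eq hde ⟨C, hS⟩, fun T hT => ?_⟩
  exact (LinearMap.extendOfNorm_unique hde C hS T (LinearMap.ext hT)).symm

end FourierIntegralOperator

end SGFIO

theorem mainTheorem4 (d : ℕ) (r ρ : ℝ) (hr : 0 ≤ r) (hρ : 0 ≤ ρ)
    (φ : EuclideanSpace ℝ (Fin d) × EuclideanSpace ℝ (Fin d) → ℝ)
    (hφ : SGFIO.IsRegularPhase φ)
    (a : EuclideanSpace ℝ (Fin d) × EuclideanSpace ℝ (Fin d) → ℂ)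
    (ha : SGFIO.IsSG 0 0 r ρ a) :
    ∃! T : Lp ℂ 2 (volume : Measure (EuclideanSpace ℝ (Fin d))) →L[ℂ]
        Lp ℂ 2 (volume : Measure (EuclideanSpace ℝ (Fin d))),
      ∀ f : 𝓢(EuclideanSpace ℝ (Fin d), ℂ),
        T (f.toLp 2 volume) =ᵐ[volume] SGFIO.Op φ a f := by
  obtain ⟨A, hA, hAf⟩ := SGFIO.exists_eLpNorm_Op_le hr hρ hφ ha
  obtain ⟨D, hD⟩ := (ha.bddDerivs hr hρ 0).bdd
  have hD' : ∀ p, ‖a p‖ ≤ D := fun p => hD () p (Set.mem_univ p)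
  have hφc := hφ.isSG.1.continuous
  have hac := ha.1.continuous
  have hmem : ∀ f : 𝓢(EuclideanSpace ℝ (Fin d), ℂ), MemLp (SGFIO.Op φ a f) 2 volume := fun f =>
    ⟨(SGFIO.continuous_Op hφc hac hD' f).aestronglyMeasurable,
      (hAf f).trans_lt (ENNReal.mul_lt_top hA.lt_top (f.memLp 2 volume).eLpNorm_lt_top)⟩
  obtain ⟨S, hS⟩ : ∃ S : 𝓢(EuclideanSpace ℝ (Fin d), ℂ) →ₗ[ℂ]
      Lp ℂ 2 (volume : Measure (EuclideanSpace ℝ (Fin d))), ∀ f, S f = (hmem f).toLp :=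
    ⟨{ toFun := fun f => (hmem f).toLp
       map_add' := fun f g => by
         rw [← MemLp.toLp_add]
         exact MemLp.toLp_congr _ _ (.of_eq (SGFIO.Op_add hφc hac hD' f g))
       map_smul' := fun c f => by
         rw [RingHom.id_apply, ← MemLp.toLp_const_smul]
         exact MemLp.toLp_congr _ _ (.of_eq (SGFIO.Op_smul φ a c f)) }, fun _ => rfl⟩
  have hSb : ∀ f, ‖S f‖ ≤ A.toReal * ‖f.toLp 2 volume‖ := fun f => by
    rw [hS, Lp.norm_toLp, SchwartzMap.norm_toLp, ← ENNReal.toReal_mul]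
    exact ENNReal.toReal_mono (ENNReal.mul_ne_top hA (f.memLp 2 volume).eLpNorm_ne_top) (hAf f)
  obtain ⟨T, hT, hTu⟩ := SGFIO.existsUnique_extension S hSb
  -- Agreement almost everywhere with `Op φ a f` is equality with `S f` in `L²`, so both existence
  -- and uniqueness reduce to those of the extension of `S`.
  refine ⟨T, fun f => ?_, fun T' hT' => hTu T' fun f => ?_⟩
  · rw [hT f, hS f]
    exact (hmem f).coeFn_toLp
  · rw [hS f]
    exact Lp.ext ((hT' f).trans (hmem f).coeFn_toLp.symm)
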